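/- **Setting.** Let $\mathcal S,\mathcal A,\mathcal B$ be finite non-empty sets, $H,K\ge 1$ and $\delta\in(0,1)$. Consider an episodic two-player zero-sum Markov game with fixed initial state $s_1$, mean rewards $r_h:\mathcal S\times\mathcal A\times\mathcal B\to[0,1]$, and single-controller transitions $\mathcal P_h(s'\mid s,a)$, $h=1,\dots,H$, which depend only on Player 1's action $a$. For policies $\mu=\{\mu_h(\cdot\mid s)\}$ of Player 1 and $\nu=\{\nu_h(\cdot\mid s)\}$ of Player 2 let $V_1^{\mu,\nu}(s_1)=\mathbb E_{\mu,\mathcal P,\nu}\big[\sum_{h=1}^H r_h(s_h,a_h,b_h)\mid s_1\big]$. The game is played for $K$ episodes. In episode $k$ the players use policies $\mu^k,\nu^k$; the episode starts in $s_1$, the actions $a_h^k\sim\mu_h^k(\cdot\mid s_h^k)$ and $b_h^k\sim\nu_h^k(\cdot\mid s_h^k)$ are drawn simultaneously and independently, and $s_{h+1}^k\sim\mathcal P_h(\cdot\mid s_h^k,a_h^k)$. Only the trajectory and the rewards $r_h^k\in[0,1]$ received along it are observed; given the previous episodes and the current $(s_h^k,a_h^k,b_h^k)$, the reward $r_h^k$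 has mean $r_h(s_h^k,a_h^k,b_h^k)$. Player 1's policies are arbitrary and possibly adversarial: $\mu^k$ may be any (measurable) function of the information available before episode $k$. Player 2's regret is $$\mathrm{Regret}_2(K)=\sum_{k=1}^K V_1^{\mu^k,\nu^k}(s_1)-\min_{\nu}\sum_{k=1}^K V_1^{\mu^k,\nu}(s_1).$$ **Algorithm of Player 2.** Let $N_h^k(s,a,b)$ and $N_h^k(s,a)$ be the numbers of visits at step $h$ in the episodes $1,\dots,k$. For $k\ge 1$ put $$\hat r_h^k(s,a,b)=\frac{\sum_{\tau=1}^k \mathbf 1\{(s_h^\tau,a_h^\tau,b_h^\tau)=(s,a,b)\}\,r_h^\tau}{\max\{N_h^k(s,a,b),1\}},\qquad \hat{\mathcal P}_h^k(s'\mid s,a)=\frac{\sum_{\tau=1}^k \mathbf 1\{(s_h^\tau,a_h^\tau,s_{h+1}^\tau)=(s,a,s')\}}{\max\{N_h^k(s,a),1\}},$$ $$\beta_h^{r,k}(s,a,b)=\sqrt{\frac{4\log(|\mathcal S||\mathcal A||\mathcal B|HK/\delta)}{\max\{N_h^k(s,a,b),1\}}},$$ and put $\hat r^0=\beta^{r,0}=0$,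 $\hat{\mathcal P}^0_h(\cdot\mid s,a)=1/|\mathcal S|$. Let $\tilde r_h^k=\max\{\hat r_h^k-\beta_h^{r,k},0\}$, and let $d_h^k(s)$ be the probability of reaching $s$ at step $h$ from $s_1$ under $\mu^k$ and the empirical transitions, i.e. $d_1^k(s)=\mathbf 1\{s=s_1\}$ and $d_{h+1}^k(s')=\sum_{s,a}d_h^k(s)\mu_h^k(a\mid s)\hat{\mathcal P}_h^k(s'\mid s,a)$. Player 2 starts with the uniform policy $\nu_h^0(\cdot\mid s)=1/|\mathcal B|$ ($\mu^0$ being arbitrary) and, for $k=1,\dots,K$, takes for $\nu^k$ the solution, at every state $s$, of the mirror descent problem $$\min_{\nu}\ \sum_{h=1}^H\Big\{d_h^{k-1}(s)\,[\mu_h^{k-1}(\cdot\mid s)]^\top\tilde r_h^{k-1}(s,\cdot,\cdot)\,[\nu_h(\cdot\mid s)-\nu_h^{k-1}(\cdot\mid s)]+\gamma^{-1}D_{\mathrm{KL}}\big(\nu_h(\cdot\mid s),\nu_h^{k-1}(\cdot\mid s)\big)\Big\}$$ with step size $\gamma=\sqrt{|\mathcal S|\log|\mathcal B|/K}$ (if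 $|\mathcal B|=1$, the only policy is taken). **Theorem.** There are universal constants $c>0$ and $p\in\mathbb N$ such that in every such game, for all $H,K\ge1$, all $\delta\in(0,1)$ and every behaviour of Player 1 as above, with probability at least $1-2\delta$, $$\mathrm{Regret}_2(K)\ \le\ c\,\Big(\log\frac{|\mathcal S||\mathcal A||\mathcal B|HK}{\delta}\Big)^{p}\,C\sqrt T,\qquad T=KH,\quad C=\sqrt{|\mathcal S|^2|\mathcal A|H^3}+\sqrt{|\mathcal S||\mathcal A||\mathcal B|H}.$$ In other words, $\mathrm{Regret}_2(K)\le\tilde{\mathcal O}(C\sqrt T)$. -/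

import Mathlib

open MeasureTheory ProbabilityTheory
open scoped BigOperators

/-!  Episodic two-player zero-sum Markov games whose transitions are controlled by Player 1.
Steps are indexed by `Fin H` (step `h` of the usual numbering `1, …, H` is the index `h - 1`),
states along an episode by `Fin (H + 1)`, and episodes by `1, …, K`; the index `0` is used for
the initialization of the algorithm. -/

namespace MarkovGame

/-- A (Markov, step-dependent) family of weights on the actions `X`: `π h s x` is `π_h(x | s)`. -/
abbrev Policy (S X : Type*) (H : ℕ) := Fin H → S → X → ℝ

/-- `π_h(· | s)` is a probability distribution on `X` for all `h` and `s`. -/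
def IsPolicy {S X : Type*} [Fintype X] {H : ℕ} (π : Policy S X H) : Prop :=
  ∀ h s, π h s ∈ stdSimplex ℝ X

/-- A Markov game with single-controller transition: transition kernel `P_h(s' | s, a)`,
mean reward `r_h(s, a, b) ∈ [0, 1]`, and fixed initial state `s₁`. -/
structure Game (S A B : Type*) [Fintype S] (H : ℕ) where
  P : Fin H → S → A → S → ℝ
  P_mem : ∀ h s a, P h s a ∈ stdSimplex ℝ S
  r : Fin H → S → A → B → ℝ
  r_mem : ∀ h s a b, r h s a b ∈ Set.Icc (0 : ℝ) 1
  s₁ : S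

/-- The trajectory of one episode: the states `s_1, …, s_{H+1}` and the actions of both players. -/
abbrev Traj (S A B : Type*) (H : ℕ) := (Fin (H + 1) → S) × (Fin H → A) × (Fin H → B)

namespace Traj

variable {S A B : Type*} {H : ℕ}

/-- The state at step `h`. -/
def st (t : Traj S A B H) (h : Fin H) : S := t.1 h.castSucc

/-- The state reached after step `h`. -/
def next (t : Traj S A B H) (h : Fin H) : S := t.1 h.succ

/-- The action of Player 1 at step `h`. -/
def act₁ (t : Traj S A B H) (h : Fin H) : A := t.2.1 h

/-- The action of Player 2 at step `h`. -/
def act₂ (t : Traj S A B H) (h : Fin H) : B := t.2.2 h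

end Traj

section Game

variable {S A B : Type*} [Fintype S] [DecidableEq S] [Fintype A] [DecidableEq A]
  [Fintype B] [DecidableEq B] {H : ℕ}

/-- The probability of the trajectory `t` in one episode that starts in `s₁`, when at each step
the players draw their actions simultaneously and independently from `μ_h(· | s_h)` and
`ν_h(· | s_h)`, and then `s_{h+1}` is drawn from `P_h(· | s_h, a_h)`. -/
noncomputable def trajProb (G : Game S A B H) (μ : Policy S A H) (ν : Policy S B H)
    (t : Traj S A B H) : ℝ :=
  (if t.1 0 = G.s₁ then 1 else 0) *
    ∏ h : Fin H, μ h (t.st h) (t.act₁ h) * ν h (t.st h) (t.act₂ h) *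
      G.P h (t.st h) (t.act₁ h) (t.next h)

/-- The value `V_1^{μ,ν}(s₁) = E_{μ,P,ν}[∑_h r_h(s_h, a_h, b_h) | s_1 = s₁]`. -/
noncomputable def value (G : Game S A B H) (μ : Policy S A H) (ν : Policy S B H) : ℝ :=
  ∑ t : Traj S A B H, trajProb G μ ν t * ∑ h : Fin H, G.r h (t.st h) (t.act₁ h) (t.act₂ h)

/-- Regret of Player 2 over the episodes `1, …, K`: the comparator is a policy of Player 2 that is
best in hindsight against `μ^1, …, μ^K`. -/
noncomputable def regret₂ (G : Game S A B H) (K : ℕ) (μ : ℕ → Policy S A H)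
    (ν : ℕ → Policy S B H) : ℝ :=
  (∑ k ∈ Finset.Icc 1 K, value G (μ k) (ν k)) -
    ⨅ ν' : {ν' : Policy S B H // IsPolicy ν'}, ∑ k ∈ Finset.Icc 1 K, value G (μ k) ν'

/-- `Pr(s_h = s | μ, Q, s₁)`, computed forward in `h`, when the transitions are `Q`. -/
noncomputable def reach (s₁ : S) (μ : Policy S A H) (Q : Fin H → S → A → S → ℝ) :
    Fin (H + 1) → S → ℝ :=
  Fin.induction (motive := fun _ => S → ℝ) (fun s => if s = s₁ then 1 else 0)
    (fun h d s' => ∑ s : S, ∑ a : A, d s * μ h s a * Q h s a s')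

/-! Empirical estimates after `k` episodes, from the trajectories `t 1, …, t k` and from the
observed rewards, `R τ h` being the reward received at step `h` of episode `τ`. -/

/-- `N_h^k(s, a, b)`: number of visits in the episodes `1, …, k`. -/
def count₃ (t : ℕ → Traj S A B H) (k : ℕ) (h : Fin H) (s : S) (a : A) (b : B) : ℕ :=
  ((Finset.Icc 1 k).filter
    (fun τ => (t τ).st h = s ∧ (t τ).act₁ h = a ∧ (t τ).act₂ h = b)).card

/-- `N_h^k(s, a)`. -/
def count₂ (t : ℕ → Traj S A B H) (k : ℕ) (h : Fin H) (s : S) (a : A) : ℕ :=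
  ((Finset.Icc 1 k).filter (fun τ => (t τ).st h = s ∧ (t τ).act₁ h = a)).card

/-- The empirical reward. It is `0` for `k = 0` and for unvisited `(s, a, b)`. -/
noncomputable def rHat (t : ℕ → Traj S A B H) (R : ℕ → Fin H → ℝ) (k : ℕ)
    (h : Fin H) (s : S) (a : A) (b : B) : ℝ :=
  (∑ τ ∈ Finset.Icc 1 k,
      if (t τ).st h = s ∧ (t τ).act₁ h = a ∧ (t τ).act₂ h = b then R τ h else 0) /
    max (count₃ t k h s a b : ℝ) 1

/-- The empirical transition model; uniform for `k = 0`. -/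
noncomputable def pHat (t : ℕ → Traj S A B H) (k : ℕ) (h : Fin H) (s : S) (a : A) (s' : S) : ℝ :=
  if k = 0 then 1 / (Fintype.card S : ℝ)
  else (((Finset.Icc 1 k).filter
      (fun τ => (t τ).st h = s ∧ (t τ).act₁ h = a ∧ (t τ).next h = s')).card : ℝ) /
    max (count₂ t k h s a : ℝ) 1

/-- The reward bonus `β_h^{r,k}(s, a, b)` for `K` episodes and confidence `δ`; `0` for `k = 0`. -/
noncomputable def bonus (K : ℕ) (δ : ℝ) (t : ℕ → Traj S A B H) (k : ℕ)
    (h : Fin H) (s : S) (a : A) (b : B) : ℝ :=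
  if k = 0 then 0
  else Real.sqrt (4 * Real.log
      ((Fintype.card S : ℝ) * Fintype.card A * Fintype.card B * H * K / δ) /
    max (count₃ t k h s a b : ℝ) 1)

/-- The pessimistic reward estimate (Player 2 minimizes) `r̃ = max {r̂ - β, 0}`. -/
noncomputable def rTilde (K : ℕ) (δ : ℝ) (t : ℕ → Traj S A B H) (R : ℕ → Fin H → ℝ) (k : ℕ)
    (h : Fin H) (s : S) (a : A) (b : B) : ℝ :=
  max (rHat t R k h s a b - bonus K δ t k h s a b) 0

/-- Kullback–Leibler divergence `D(p, q)` of distributions on a finite set, where `q` has full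
support (as all iterates of the algorithm below do). -/
noncomputable def klDist {X : Type*} [Fintype X] (p q : X → ℝ) : ℝ :=
  ∑ x : X, p x * Real.log (p x / q x)

/-- The step size `γ = √(|S| log |B| / K)`. -/
noncomputable def stepSize (S B : Type*) [Fintype S] [Fintype B] (K : ℕ) : ℝ :=
  Real.sqrt ((Fintype.card S : ℝ) * Real.log (Fintype.card B) / K)

/-- The objective, at the state `s`, of the mirror descent step that follows episode `k`:
`∑_h { d_h^k(s) [μ_h^k(·|s)]ᵀ r̃_h^k(s,·,·) [ν'_h(·|s) - ν_h^k(·|s)] + γ⁻¹ D(ν'_h(·|s), ν_h^k(·|s)) }`,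
where `d_h^k` is the state reaching probability under `μ^k` and the empirical transitions.
Here `μ = μ^k` and `ν = ν^k`. -/
noncomputable def objective (s₁ : S) (K : ℕ) (δ : ℝ) (t : ℕ → Traj S A B H)
    (R : ℕ → Fin H → ℝ) (k : ℕ) (μ : Policy S A H) (ν : Policy S B H) (s : S)
    (ν' : Policy S B H) : ℝ :=
  ∑ h : Fin H,
    (reach s₁ μ (pHat t k) h.castSucc s *
        (∑ a : A, ∑ b : B, μ h s a * rTilde K δ t R k h s a b * (ν' h s b - ν h s b)) +
      (stepSize S B K)⁻¹ * klDist (ν' h s) (ν h s))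

/-- Player 2 runs the optimistic policy optimization algorithm for `K` episodes: `ν^0` is uniform,
and `ν^{k+1}` solves, at every state, the mirror descent problem formed with Player 1's previous
policy `μ^k` and the data of the episodes `1, …, k`. -/
def RunsAlgorithm (s₁ : S) (K : ℕ) (δ : ℝ) (t : ℕ → Traj S A B H) (R : ℕ → Fin H → ℝ)
    (μ : ℕ → Policy S A H) (ν : ℕ → Policy S B H) : Prop :=
  (∀ h s b, ν 0 h s b = 1 / (Fintype.card B : ℝ)) ∧
    ∀ k < K, IsPolicy (ν (k + 1)) ∧
      ∀ s, IsMinOn (objective s₁ K δ t R k (μ k) (ν k) s) {ν' | IsPolicy ν'} (ν (k + 1))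

/-- `K` episodes of the game are played on the probability space `(Ω, Pr)`; `ℱ k` is the information
available after episode `k`. In episode `k`, the players use `μ^k` and `ν^k`, the trajectory is
`t k`, and the reward received at step `h` is `R k · h`.
* Player 1's policy `μ^{k+1}` is an arbitrary, possibly adversarial, function of the information
  after episode `k` (which may contain private randomness).
* Given that information, the trajectory of episode `k + 1` has the law determined by
  `μ^{k+1}`, `ν^{k+1}` and the transitions of the game.
* The rewards are random, lie in `[0, 1]`, and given the past episodes and the current
  `(s_h, a_h, b_h)` their mean is `r_h(s_h, a_h, b_h)`. -/
structure IsPlay {Ω : Type*} {mΩ : MeasurableSpace Ω} (G : Game S A B H) (K : ℕ)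
    (Pr : Measure Ω) (ℱ : Filtration ℕ mΩ) (μ : ℕ → Ω → Policy S A H) (ν : ℕ → Ω → Policy S B H)
    (t : ℕ → Ω → Traj S A B H) (R : ℕ → Ω → Fin H → ℝ) : Prop where
  policy₁ : ∀ k < K, ∀ ω, IsPolicy (μ (k + 1) ω)
  policy₁_meas : ∀ k < K, ∀ h s a, Measurable[ℱ k] (fun ω => μ (k + 1) ω h s a)
  traj_meas : ∀ k < K, ∀ x, MeasurableSet[ℱ (k + 1)] {ω | t (k + 1) ω = x}
  reward_meas : ∀ k < K, ∀ h, Measurable[ℱ (k + 1)] (fun ω => R (k + 1) ω h)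
  traj_law : ∀ k < K, ∀ x,
    Pr[Set.indicator {ω | t (k + 1) ω = x} (fun _ => (1 : ℝ)) | ℱ k]
      =ᵐ[Pr] fun ω => trajProb G (μ (k + 1) ω) (ν (k + 1) ω) x
  reward_mem : ∀ k < K, ∀ ω h, R (k + 1) ω h ∈ Set.Icc (0 : ℝ) 1
  reward_mean : ∀ k < K, ∀ h,
    Pr[fun ω => R (k + 1) ω h | ℱ k ⊔ MeasurableSpace.comap
        (fun ω => ((t (k + 1) ω).st h, (t (k + 1) ω).act₁ h, (t (k + 1) ω).act₂ h)) ⊤]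
      =ᵐ[Pr] fun ω =>
        G.r h ((t (k + 1) ω).st h) ((t (k + 1) ω).act₁ h) ((t (k + 1) ω).act₂ h)

end Game

end MarkovGame

/-!
Since the transitions are controlled by Player 1, the state distributions `q^k` of episode `k` do
not depend on Player 2, and the value is linear in Player 2's policy (`value_eq`). With the
pessimistic rewards `r̃^k` and the state distributions `d^k` under the empirical model, the regret
against a fixed policy splits, at every step and state (`loss_sub_le`), into

* the reward error `q^k μ^k (r - r̃^k) ν^k`, at most twice the bonus under the true law of play,
* the pessimism term of the comparator, which is nonpositive as soon as `r̃^k ≤ r`,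
* the model error `‖q^k - d^k‖₁`, at most the accumulated one-step `ℓ¹` errors of the empirical
  transitions weighted by `q^k` (`sum_abs_reach_sub_le`), and
* the regret of mirror descent for the losses `d^k μ^k r̃^k` that the algorithm really uses.

The mirror descent problem decouples over steps, and Gibbs' variational identity
(`klDist_add_eq`) shows that its solution is the multiplicative weights update; the usual
potential argument (`mw_regret_le`) together with `∑_s d^k(s) ≤ 1` bounds the last part by
`(3/2) H √(|S| K log |B|)`.

For the estimation errors one needs that empirical means over `n` visits are accurate up to
`√(L / n)`, where `L` is the logarithm in the statement, and that the inverse square roots of the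
visit counts sum to `O(√(|X| K))`, both along the realized play (`sum_one_div_sqrt_visits_le`) and
in conditional mean. All of this follows from one self-normalized inequality for martingale
differences (`measureReal_sqrt_lt_sum_le`): if `|X| ≤ c` with `c ∈ {0, 1}`, then
`exp (θ X - θ² c / 2)` is bounded by an affine function of `X` with value `1` at `0`, so that an
exponential supermartingale is available although the visits `c` are not predictable. The `ℓ¹`
errors of the transitions are obtained from the sign vectors on the state space. A union bound
(`IsPlay.exists_goodRun`) gives all the estimates at once with probability at least `1 - 2 δ` when
`δ ≤ 1 / 2`; for larger `δ` there is nothing to prove.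
-/

namespace MarkovGame

/-! ### Marginals of the trajectory law -/

section Marginals

variable {S A B : Type*} [Fintype S] [Fintype A] [Fintype B]

/-- The state distribution at each step when the initial state has the weights `ρ`. -/
noncomputable def reachFrom {H : ℕ} (ρ : S → ℝ) (μ : Policy S A H) (Q : Fin H → S → A → S → ℝ) :
    Fin (H + 1) → S → ℝ :=
  Fin.induction (motive := fun _ => S → ℝ) ρ
    (fun h d s' => ∑ s : S, ∑ a : A, d s * μ h s a * Q h s a s')

/-- The weight of a trajectory whose initial state has the weights `ρ`. -/
noncomputable def pathWeight {H : ℕ} (ρ : S → ℝ) (μ : Policy S A H) (ν : Policy S B H)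
    (Q : Fin H → S → A → S → ℝ) (t : Traj S A B H) : ℝ :=
  ρ (t.1 0) * ∏ h : Fin H, μ h (t.st h) (t.act₁ h) * ν h (t.st h) (t.act₂ h) *
    Q h (t.st h) (t.act₁ h) (t.next h)

lemma reachFrom_zero {H : ℕ} (ρ : S → ℝ) (μ : Policy S A H) (Q : Fin H → S → A → S → ℝ) :
    reachFrom ρ μ Q 0 = ρ := rfl

lemma reachFrom_succ {H : ℕ} (ρ : S → ℝ) (μ : Policy S A H) (Q : Fin H → S → A → S → ℝ)
    (h : Fin H) (s' : S) :
    reachFrom ρ μ Q h.succ s' =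
      ∑ s : S, ∑ a : A, reachFrom ρ μ Q h.castSucc s * μ h s a * Q h s a s' := rfl

lemma reach_eq_reachFrom [DecidableEq S] {H : ℕ} (s₁ : S) (μ : Policy S A H)
    (Q : Fin H → S → A → S → ℝ) :
    reach s₁ μ Q = reachFrom (fun s => if s = s₁ then 1 else 0) μ Q := rfl

/-- Running the chain from `ρ` is running it from the state distribution after the first step. -/
lemma reachFrom_succ_eq {H : ℕ} (ρ : S → ℝ) (μ : Policy S A (H + 1))
    (Q : Fin (H + 1) → S → A → S → ℝ) (j : Fin (H + 1)) :
    reachFrom ρ μ Q j.succ =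
      reachFrom (fun s' => ∑ s : S, ∑ a : A, ρ s * μ 0 s a * Q 0 s a s')
        (fun h => μ h.succ) (fun h => Q h.succ) j := by
  induction j using Fin.induction with
  | zero => rfl
  | succ i ih =>
    funext s'
    rw [reachFrom_succ, reachFrom_succ, Fin.castSucc_succ, ih]

lemma sum_traj_succ {H : ℕ} (F : Traj S A B (H + 1) → ℝ) :
    ∑ t, F t = ∑ y : Traj S A B H, ∑ s : S, ∑ a : A, ∑ b : B,
      F (Fin.cons s y.1, Fin.cons a y.2.1, Fin.cons b y.2.2) := by
  let e : Traj S A B H × (S × A × B) ≃ Traj S A B (H + 1) :=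
    { toFun := fun p => (Fin.cons p.2.1 p.1.1, Fin.cons p.2.2.1 p.1.2.1, Fin.cons p.2.2.2 p.1.2.2)
      invFun := fun t => ((Fin.tail t.1, Fin.tail t.2.1, Fin.tail t.2.2), (t.1 0, t.2.1 0, t.2.2 0))
      left_inv := fun p => by simp
      right_inv := fun t => by simp }
  rw [← e.sum_comp]
  simp only [Fintype.sum_prod_type]
  rfl

/-- Summing out the first step of a trajectory, against a function of that step and a function of
the remaining steps. -/
lemma sum_pathWeight_succ {H : ℕ} (ρ : S → ℝ) (μ : Policy S A (H + 1)) (ν : Policy S B (H + 1))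
    (Q : Fin (H + 1) → S → A → S → ℝ) (f : S → A → B → S → ℝ) (F : Traj S A B H → ℝ) :
    ∑ t : Traj S A B (H + 1), pathWeight ρ μ ν Q t *
        (f (t.st 0) (t.act₁ 0) (t.act₂ 0) (t.next 0) *
          F (Fin.tail t.1, Fin.tail t.2.1, Fin.tail t.2.2)) =
      ∑ y : Traj S A B H, pathWeight
        (fun s' => ∑ s : S, ∑ a : A, ∑ b : B, ρ s * μ 0 s a * ν 0 s b * Q 0 s a s' * f s a b s')
        (fun h => μ h.succ) (fun h => ν h.succ) (fun h => Q h.succ) y * F y := by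
  rw [sum_traj_succ]
  refine Finset.sum_congr rfl fun y _ => ?_
  simp only [pathWeight, Finset.sum_mul]
  refine Finset.sum_congr rfl fun s _ => Finset.sum_congr rfl fun a _ =>
    Finset.sum_congr rfl fun b _ => ?_
  rw [Fin.prod_univ_succ]
  simp only [Traj.st, Traj.act₁, Traj.act₂, Traj.next, Fin.cons_zero, Fin.cons_succ, Fin.tail_cons,
    Fin.castSucc_zero, Fin.castSucc_succ]
  ring

variable {H : ℕ}

lemma trajProb_eq_pathWeight {S A B : Type*} [Fintype S] [DecidableEq S] (G : Game S A B H)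
    (μ : Policy S A H) (ν : Policy S B H) (t : Traj S A B H) :
    trajProb G μ ν t = pathWeight (fun s => if s = G.s₁ then 1 else 0) μ ν G.P t := rfl

/-- The trajectory weights have the total mass of the initial weights. -/
lemma sum_pathWeight (ρ : S → ℝ) (μ : Policy S A H) (ν : Policy S B H)
    (Q : Fin H → S → A → S → ℝ) (hμ : IsPolicy μ) (hν : IsPolicy ν)
    (hQ : ∀ h s a, ∑ s', Q h s a s' = 1) :
    ∑ t, pathWeight ρ μ ν Q t = ∑ s, ρ s := by
  induction H generalizing ρ with
  | zero =>
    simp only [pathWeight, Finset.univ_eq_empty, Finset.prod_empty, mul_one,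
      Fintype.sum_prod_type, Fintype.sum_unique]
    exact Fintype.sum_equiv (Equiv.funUnique (Fin 1) S) _ _ (fun x => rfl)
  | succ H ih =>
    have h1 := sum_pathWeight_succ ρ μ ν Q (fun _ _ _ _ => 1) (fun _ => 1)
    simp only [mul_one] at h1
    rw [h1, ih _ _ _ _ (fun h => hμ h.succ) (fun h => hν h.succ) (fun h => hQ h.succ),
      Finset.sum_comm]
    refine Finset.sum_congr rfl fun s _ => ?_
    rw [Finset.sum_comm]
    simp_rw [Finset.sum_comm (s := (Finset.univ : Finset S)), ← Finset.mul_sum, hQ, mul_one,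
      ← Finset.mul_sum, (hν 0 s).2, mul_one, ← Finset.mul_sum, (hμ 0 s).2, mul_one]

/-- The joint law of a step `(s_h, a_h, b_h, s_{h+1})` of the trajectory. The law of `s_h` does not
involve Player 2's policy, since the transitions do not. -/
lemma sum_pathWeight_mul (ρ : S → ℝ) (μ : Policy S A H) (ν : Policy S B H)
    (Q : Fin H → S → A → S → ℝ) (hμ : IsPolicy μ) (hν : IsPolicy ν)
    (hQ : ∀ h s a, ∑ s', Q h s a s' = 1) (h : Fin H) (f : S → A → B → S → ℝ) :
    ∑ t, pathWeight ρ μ ν Q t * f (t.st h) (t.act₁ h) (t.act₂ h) (t.next h) =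
      ∑ s, ∑ a, ∑ b, ∑ s', reachFrom ρ μ Q h.castSucc s * μ h s a * ν h s b * Q h s a s' *
        f s a b s' := by
  induction H generalizing ρ with
  | zero => exact h.elim0
  | succ H ih =>
    induction h using Fin.cases with
    | zero =>
      have h1 := sum_pathWeight_succ ρ μ ν Q f (fun _ => 1)
      simp only [mul_one] at h1
      rw [h1, sum_pathWeight _ _ _ _ (fun h => hμ h.succ) (fun h => hν h.succ)
        (fun h => hQ h.succ), Finset.sum_comm]
      refine Finset.sum_congr rfl fun s _ => ?_
      rw [Finset.sum_comm]
      refine Finset.sum_congr rfl fun a _ => ?_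
      rw [Finset.sum_comm]
      rfl
    | succ j =>
      have h1 := sum_pathWeight_succ ρ μ ν Q (fun _ _ _ _ => 1)
        (fun y => f (y.st j) (y.act₁ j) (y.act₂ j) (y.next j))
      simp only [mul_one, one_mul] at h1
      have h2 := ih (fun s' => ∑ s : S, ∑ a : A, ∑ b : B, ρ s * μ 0 s a * ν 0 s b * Q 0 s a s')
        (fun h => μ h.succ) (fun h => ν h.succ) (fun h => Q h.succ)
        (fun h => hμ h.succ) (fun h => hν h.succ) (fun h => hQ h.succ) j
      refine (Eq.trans ?_ h1).trans (h2.trans ?_)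
      · rfl
      · have h3 : (fun s' => ∑ s : S, ∑ a : A, ∑ b : B, ρ s * μ 0 s a * ν 0 s b * Q 0 s a s') =
            (fun s' => ∑ s : S, ∑ a : A, ρ s * μ 0 s a * Q 0 s a s') := by
          funext s'
          refine Finset.sum_congr rfl fun s _ => Finset.sum_congr rfl fun a _ => ?_
          rw [← Finset.sum_mul, ← Finset.mul_sum, (hν 0 s).2, mul_one]
        rw [h3, ← reachFrom_succ_eq]
        rfl

variable [DecidableEq S]

lemma sum_trajProb (G : Game S A B H) {μ : Policy S A H} {ν : Policy S B H}
    (hμ : IsPolicy μ) (hν : IsPolicy ν) : ∑ t, trajProb G μ ν t = 1 := by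
  simp only [trajProb_eq_pathWeight]
  rw [sum_pathWeight _ _ _ _ hμ hν (fun h s a => (G.P_mem h s a).2)]
  simp

lemma trajProb_nonneg (G : Game S A B H) {μ : Policy S A H} {ν : Policy S B H}
    (hμ : IsPolicy μ) (hν : IsPolicy ν) (t : Traj S A B H) : 0 ≤ trajProb G μ ν t := by
  refine mul_nonneg (by split_ifs <;> norm_num) (Finset.prod_nonneg fun h _ => ?_)
  exact mul_nonneg (mul_nonneg ((hμ h _).1 _) ((hν h _).1 _)) ((G.P_mem h _ _).1 _)

lemma sum_trajProb_mul_next (G : Game S A B H) {μ : Policy S A H} {ν : Policy S B H}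
    (hμ : IsPolicy μ) (hν : IsPolicy ν) (h : Fin H) (f : S → A → S → ℝ) :
    ∑ t, trajProb G μ ν t * f (t.st h) (t.act₁ h) (t.next h) =
      ∑ s, ∑ a, reach G.s₁ μ G.P h.castSucc s * μ h s a * ∑ s', G.P h s a s' * f s a s' := by
  have h1 := sum_pathWeight_mul (fun s => if s = G.s₁ then 1 else 0) μ ν G.P hμ hν
    (fun h s a => (G.P_mem h s a).2) h (fun s a _ s' => f s a s')
  simp only [← trajProb_eq_pathWeight] at h1
  rw [h1, reach_eq_reachFrom]
  refine Finset.sum_congr rfl fun s _ => Finset.sum_congr rfl fun a _ => ?_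
  rw [Finset.sum_comm, Finset.mul_sum]
  refine Finset.sum_congr rfl fun s' _ => ?_
  rw [← Finset.sum_mul, ← Finset.sum_mul, ← Finset.mul_sum, (hν h s).2]
  ring

lemma sum_trajProb_mul_act (G : Game S A B H) {μ : Policy S A H} {ν : Policy S B H}
    (hμ : IsPolicy μ) (hν : IsPolicy ν) (h : Fin H) (f : S → A → B → ℝ) :
    ∑ t, trajProb G μ ν t * f (t.st h) (t.act₁ h) (t.act₂ h) =
      ∑ s, ∑ a, ∑ b, reach G.s₁ μ G.P h.castSucc s * μ h s a * ν h s b * f s a b := by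
  have h1 := sum_pathWeight_mul (fun s => if s = G.s₁ then 1 else 0) μ ν G.P hμ hν
    (fun h s a => (G.P_mem h s a).2) h (fun s a b _ => f s a b)
  simp only [← trajProb_eq_pathWeight] at h1
  rw [h1, reach_eq_reachFrom]
  refine Finset.sum_congr rfl fun s _ => Finset.sum_congr rfl fun a _ =>
    Finset.sum_congr rfl fun b _ => ?_
  rw [← Finset.sum_mul, ← Finset.mul_sum, (G.P_mem h s a).2, mul_one]

/-- The value is linear in Player 2's policy, with weights that involve only Player 1's. -/
lemma value_eq (G : Game S A B H) {μ : Policy S A H} {ν : Policy S B H}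
    (hμ : IsPolicy μ) (hν : IsPolicy ν) :
    value G μ ν = ∑ h : Fin H, ∑ s, ∑ a, ∑ b,
      reach G.s₁ μ G.P h.castSucc s * μ h s a * ν h s b * G.r h s a b := by
  simp only [value, Finset.mul_sum]
  rw [Finset.sum_comm]
  exact Finset.sum_congr rfl fun h _ => sum_trajProb_mul_act G hμ hν h (G.r h)

end Marginals

/-! ### State distributions under two transition models -/

section Reach

variable {S A : Type*} [Fintype S] [Fintype A]

lemma sum_mul_substochastic_le (u : S → ℝ) (hu : ∀ s, 0 ≤ u s) (μ : S → A → ℝ)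
    (hμ : ∀ s, μ s ∈ stdSimplex ℝ A) (Q : S → A → S → ℝ) (hQ1 : ∀ s a, ∑ s', Q s a s' ≤ 1) :
    ∑ s', ∑ s, ∑ a, u s * μ s a * Q s a s' ≤ ∑ s, u s := by
  rw [Finset.sum_comm]
  refine Finset.sum_le_sum fun s _ => ?_
  rw [Finset.sum_comm]
  calc ∑ a, ∑ s', u s * μ s a * Q s a s' = ∑ a, u s * μ s a * ∑ s', Q s a s' := by
        simp only [Finset.mul_sum]
    _ ≤ ∑ a, u s * μ s a * 1 := Finset.sum_le_sum fun a _ =>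
        mul_le_mul_of_nonneg_left (hQ1 s a) (mul_nonneg (hu s) ((hμ s).1 a))
    _ = u s := by simp only [mul_one, ← Finset.mul_sum, (hμ s).2]

variable [DecidableEq S] {H : ℕ}

lemma reach_nonneg (s₁ : S) {μ : Policy S A H} {Q : Fin H → S → A → S → ℝ} (hμ : IsPolicy μ)
    (hQ : ∀ h s a s', 0 ≤ Q h s a s') (h : Fin (H + 1)) (s : S) : 0 ≤ reach s₁ μ Q h s := by
  induction h using Fin.induction generalizing s with
  | zero => rw [reach_eq_reachFrom, reachFrom_zero]; split_ifs <;> norm_num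
  | succ i ih =>
    rw [reach_eq_reachFrom, reachFrom_succ, ← reach_eq_reachFrom]
    exact Finset.sum_nonneg fun s _ => Finset.sum_nonneg fun a _ =>
      mul_nonneg (mul_nonneg (ih s) ((hμ i s).1 a)) (hQ _ _ _ _)

lemma sum_reach_le_one (s₁ : S) {μ : Policy S A H} {Q : Fin H → S → A → S → ℝ} (hμ : IsPolicy μ)
    (hQ : ∀ h s a s', 0 ≤ Q h s a s') (hQ1 : ∀ h s a, ∑ s', Q h s a s' ≤ 1) (h : Fin (H + 1)) :
    ∑ s, reach s₁ μ Q h s ≤ 1 := by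
  induction h using Fin.induction with
  | zero => simp [reach_eq_reachFrom, reachFrom_zero]
  | succ i ih =>
    refine le_trans ?_ ih
    exact sum_mul_substochastic_le _ (reach_nonneg s₁ hμ hQ i.castSucc) (μ i) (hμ i) (Q i) (hQ1 i)

/-- The `ℓ¹` error of the state distributions is at most the accumulated one-step error of the
transition model, weighted by the true state distributions. -/
lemma sum_abs_reach_sub_le (s₁ : S) {μ : Policy S A H} {P Q : Fin H → S → A → S → ℝ}
    (hμ : IsPolicy μ) (hP : ∀ h s a s', 0 ≤ P h s a s')
    (hQ : ∀ h s a s', 0 ≤ Q h s a s') (hQ1 : ∀ h s a, ∑ s', Q h s a s' ≤ 1) (h : Fin (H + 1)) :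
    ∑ s, |reach s₁ μ P h s - reach s₁ μ Q h s| ≤
      ∑ j : Fin H, ∑ s, ∑ a, reach s₁ μ P j.castSucc s * μ j s a * ∑ s', |Q j s a s' - P j s a s'| := by
  have hterm : ∀ j : Fin H, 0 ≤ ∑ s, ∑ a, reach s₁ μ P j.castSucc s * μ j s a *
      ∑ s', |Q j s a s' - P j s a s'| := fun j =>
    Finset.sum_nonneg fun s _ => Finset.sum_nonneg fun a _ =>
      mul_nonneg (mul_nonneg (reach_nonneg s₁ hμ hP _ _) ((hμ j s).1 a))
        (Finset.sum_nonneg fun _ _ => abs_nonneg _)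
  suffices hs : ∑ s, |reach s₁ μ P h s - reach s₁ μ Q h s| ≤
      ∑ j ∈ Finset.univ.filter (fun j : Fin H => j.castSucc < h),
        ∑ s, ∑ a, reach s₁ μ P j.castSucc s * μ j s a * ∑ s', |Q j s a s' - P j s a s'| from
    hs.trans (Finset.sum_le_sum_of_subset_of_nonneg (Finset.filter_subset _ _)
      fun j _ _ => hterm j)
  induction h using Fin.induction with
  | zero => simp [reach_eq_reachFrom, reachFrom_zero]
  | succ i ih =>
    have hset : Finset.univ.filter (fun j : Fin H => j.castSucc < i.succ) =
        insert i (Finset.univ.filter (fun j : Fin H => j.castSucc < i.castSucc)) := by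
      ext j
      simp only [Finset.mem_filter, Finset.mem_univ, true_and, Finset.mem_insert, Fin.lt_def,
        Fin.val_castSucc, Fin.val_succ, Fin.ext_iff]
      omega
    rw [hset, Finset.sum_insert (by simp), add_comm]
    set d := fun s => reach s₁ μ P i.castSucc s
    set e := fun s => reach s₁ μ Q i.castSucc s
    calc ∑ s', |reach s₁ μ P i.succ s' - reach s₁ μ Q i.succ s'|
        ≤ ∑ s', (∑ s, ∑ a, |d s - e s| * μ i s a * Q i s a s' +
            ∑ s, ∑ a, d s * μ i s a * |Q i s a s' - P i s a s'|) := by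
          refine Finset.sum_le_sum fun s' _ => ?_
          have : reach s₁ μ P i.succ s' - reach s₁ μ Q i.succ s' =
              ∑ s, ∑ a, (d s - e s) * μ i s a * Q i s a s' +
              ∑ s, ∑ a, d s * μ i s a * (P i s a s' - Q i s a s') := by
            simp only [reach_eq_reachFrom, reachFrom_succ, d, e, ← Finset.sum_add_distrib,
              ← Finset.sum_sub_distrib]
            exact Finset.sum_congr rfl fun s _ => Finset.sum_congr rfl fun a _ => by ring
          rw [this]
          refine (abs_add_le _ _).trans (add_le_add ?_ ?_)
          · refine (Finset.abs_sum_le_sum_abs _ _).trans (Finset.sum_le_sum fun s _ =>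
              (Finset.abs_sum_le_sum_abs _ _).trans (Finset.sum_le_sum fun a _ => ?_))
            rw [abs_mul, abs_mul, abs_of_nonneg ((hμ i s).1 a), abs_of_nonneg (hQ i s a s')]
          · refine (Finset.abs_sum_le_sum_abs _ _).trans (Finset.sum_le_sum fun s _ =>
              (Finset.abs_sum_le_sum_abs _ _).trans (Finset.sum_le_sum fun a _ => ?_))
            rw [abs_mul, abs_mul, abs_of_nonneg ((hμ i s).1 a),
              abs_of_nonneg (reach_nonneg s₁ hμ hP _ _), abs_sub_comm]
      _ ≤ ∑ s, |d s - e s| + ∑ s, ∑ a, d s * μ i s a * ∑ s', |Q i s a s' - P i s a s'| := by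
          rw [Finset.sum_add_distrib]
          refine add_le_add (sum_mul_substochastic_le _ (fun s => abs_nonneg _) (μ i) (hμ i) (Q i)
            (hQ1 i)) (le_of_eq ?_)
          rw [Finset.sum_comm]
          refine Finset.sum_congr rfl fun s _ => ?_
          rw [Finset.sum_comm]
          simp only [Finset.mul_sum]
      _ ≤ _ := add_le_add ih le_rfl

end Reach

/-! ### Mirror descent with the Kullback–Leibler divergence -/

section MirrorDescent

variable {X : Type*} [Fintype X]

/-- The multiplicative weights update of `q` for the loss `g` with step size `γ`. -/
noncomputable def mwUpdate (γ : ℝ) (g q : X → ℝ) (x : X) : ℝ :=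
  q x * Real.exp (-(γ * g x)) / ∑ y, q y * Real.exp (-(γ * g y))

lemma mul_log_div_ge {p q : ℝ} (hp : 0 ≤ p) (hq : 0 < q) : p - q ≤ p * Real.log (p / q) := by
  rcases hp.eq_or_lt with rfl | hp
  · simp [hq.le]
  · have h := Real.one_sub_inv_le_log_of_pos (div_pos hp hq)
    calc p - q = p * (1 - (p / q)⁻¹) := by field_simp
      _ ≤ _ := mul_le_mul_of_nonneg_left h hp.le

lemma eq_of_mul_log_div_le {p q : ℝ} (hp : 0 ≤ p) (hq : 0 < q)
    (h : p * Real.log (p / q) ≤ p - q) : p = q := by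
  rcases hp.eq_or_lt with rfl | hp
  · simp at h; linarith
  · by_contra hne
    have h1 : Real.log (q / p) < q / p - 1 :=
      Real.log_lt_sub_one_of_pos (div_pos hq hp) (fun h => hne ((div_eq_one_iff_eq hp.ne').1 h).symm)
    rw [← inv_div, Real.log_inv] at h1
    have h2 : p * (-Real.log (p / q)) < p * ((p / q)⁻¹ - 1) := mul_lt_mul_of_pos_left h1 hp
    have h3 : p * ((p / q)⁻¹ - 1) = q - p := by field_simp
    linarith

lemma klDist_nonneg {p q : X → ℝ} (hp : p ∈ stdSimplex ℝ X) (hq : ∀ x, 0 < q x)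
    (hq1 : ∑ x, q x = 1) : 0 ≤ klDist p q := by
  have h := Finset.sum_le_sum fun x (_ : x ∈ Finset.univ) => mul_log_div_ge (hp.1 x) (hq x)
  rw [Finset.sum_sub_distrib, hp.2, hq1, sub_self] at h
  exact h

lemma eq_of_klDist_nonpos {p q : X → ℝ} (hp : p ∈ stdSimplex ℝ X) (hq : ∀ x, 0 < q x)
    (hq1 : ∑ x, q x = 1) (h : klDist p q ≤ 0) : p = q := by
  have h0 : ∀ x ∈ Finset.univ, 0 ≤ p x * Real.log (p x / q x) - (p x - q x) := fun x _ =>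
    sub_nonneg.2 (mul_log_div_ge (hp.1 x) (hq x))
  have h1 : ∑ x, (p x * Real.log (p x / q x) - (p x - q x)) = 0 := by
    refine le_antisymm ?_ (Finset.sum_nonneg h0)
    rw [Finset.sum_sub_distrib, Finset.sum_sub_distrib, hp.2, hq1, sub_self, sub_zero]
    exact h
  funext x
  exact eq_of_mul_log_div_le (hp.1 x) (hq x)
    (by linarith [(Finset.sum_eq_zero_iff_of_nonneg h0).1 h1 x (Finset.mem_univ x)])

lemma klDist_self {q : X → ℝ} (hq : ∀ x, 0 < q x) : klDist q q = 0 :=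
  Finset.sum_eq_zero fun x _ => by rw [div_self (hq x).ne', Real.log_one, mul_zero]

lemma klDist_uniform_le [Nonempty X] {p : X → ℝ} (hp : p ∈ stdSimplex ℝ X) :
    klDist p (fun _ => 1 / (Fintype.card X : ℝ)) ≤ Real.log (Fintype.card X) := by
  have hc : (1 : ℝ) ≤ Fintype.card X := by exact_mod_cast Fintype.card_pos
  calc klDist p (fun _ => 1 / (Fintype.card X : ℝ)) ≤ ∑ x, p x * Real.log (Fintype.card X) := by
        refine Finset.sum_le_sum fun x _ => ?_
        rcases (hp.1 x).eq_or_lt with h | h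
        · simp [← h]
        · have hx1 : p x ≤ 1 := hp.2 ▸ Finset.single_le_sum (fun y _ => hp.1 y) (Finset.mem_univ x)
          refine mul_le_mul_of_nonneg_left (Real.log_le_log (by positivity) ?_) h.le
          rw [div_div_eq_mul_div, div_one]
          nlinarith
    _ = Real.log (Fintype.card X) := by rw [← Finset.sum_mul, hp.2, one_mul]

section Update

variable [Nonempty X] (γ : ℝ) (g : X → ℝ) {q : X → ℝ}

lemma sum_mul_exp_pos (hq : ∀ x, 0 < q x) : 0 < ∑ y, q y * Real.exp (-(γ * g y)) :=
  Finset.sum_pos (fun y _ => mul_pos (hq y) (Real.exp_pos _)) Finset.univ_nonempty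

lemma mwUpdate_pos (hq : ∀ x, 0 < q x) (x : X) : 0 < mwUpdate γ g q x :=
  div_pos (mul_pos (hq x) (Real.exp_pos _)) (sum_mul_exp_pos γ g hq)

lemma sum_mwUpdate (hq : ∀ x, 0 < q x) : ∑ x, mwUpdate γ g q x = 1 := by
  simp only [mwUpdate, ← Finset.sum_div]
  exact div_self (sum_mul_exp_pos γ g hq).ne'

/-- Gibbs' variational identity: linear loss plus divergence from `q` is, up to a constant, the
divergence from the multiplicative weights update of `q`. -/
lemma klDist_add_eq (hq : ∀ x, 0 < q x) {p : X → ℝ} (hp : p ∈ stdSimplex ℝ X) :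
    γ * ∑ x, g x * p x + klDist p q =
      klDist p (mwUpdate γ g q) - Real.log (∑ y, q y * Real.exp (-(γ * g y))) := by
  have hZ := sum_mul_exp_pos γ g hq
  set Z := ∑ y, q y * Real.exp (-(γ * g y)) with hZdef
  have h : ∀ x, γ * (g x * p x) + p x * Real.log (p x / q x) =
      p x * Real.log (p x / mwUpdate γ g q x) - p x * Real.log Z := by
    intro x
    rcases (hp.1 x).eq_or_lt with h | h
    · simp [← h]
    · have hu : p x / mwUpdate γ g q x = p x / q x * (Real.exp (γ * g x) * Z) := by
        rw [mwUpdate, ← hZdef, Real.exp_neg]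
        have := (hq x).ne'
        have := (Real.exp_pos (γ * g x)).ne'
        field_simp
      rw [hu, Real.log_mul (div_pos h (hq x)).ne' (by positivity),
        Real.log_mul (Real.exp_pos _).ne' hZ.ne', Real.log_exp]
      ring
  have h1 := Finset.sum_congr rfl fun x (_ : x ∈ Finset.univ) => h x
  rw [Finset.sum_add_distrib, Finset.sum_sub_distrib, ← Finset.mul_sum, ← Finset.sum_mul, hp.2,
    one_mul] at h1
  exact h1

/-- One step of the multiplicative weights analysis for a nonnegative loss bounded by `D`. -/
lemma mwUpdate_step (hq : ∀ x, 0 < q x) (hγ : 0 ≤ γ) (hq1 : ∑ x, q x = 1) {D : ℝ} (hg : ∀ x, 0 ≤ g x)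
    (hgD : ∀ x, g x ≤ D) {p : X → ℝ} (hp : p ∈ stdSimplex ℝ X) :
    γ * ∑ x, g x * (q x - p x) ≤
      klDist p q - klDist p (mwUpdate γ g q) + γ ^ 2 / 2 * D ^ 2 := by
  have hkl := klDist_add_eq γ g hq hp
  have hZ := sum_mul_exp_pos γ g hq
  have hexp : ∀ x, Real.exp (-(γ * g x)) ≤ 1 - γ * g x + γ ^ 2 / 2 * D ^ 2 := by
    intro x
    have h0 : 0 ≤ γ * g x := mul_nonneg hγ (hg x)
    have h1 := Real.quadratic_le_exp_of_nonneg h0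
    have h2 : Real.exp (-(γ * g x)) ≤ 1 - γ * g x + (γ * g x) ^ 2 / 2 := by
      rw [Real.exp_neg, inv_le_iff_one_le_mul₀ (Real.exp_pos _)]
      have h3 : 0 ≤ 1 - γ * g x + (γ * g x) ^ 2 / 2 := by nlinarith [sq_nonneg (γ * g x - 1)]
      refine le_trans ?_ (mul_le_mul_of_nonneg_left h1 h3)
      nlinarith [sq_nonneg ((γ * g x) ^ 2)]
    have h4 : (γ * g x) ^ 2 ≤ (γ * D) ^ 2 :=
      pow_le_pow_left₀ h0 (mul_le_mul_of_nonneg_left (hgD x) hγ) 2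
    nlinarith
  have hlog : Real.log (∑ y, q y * Real.exp (-(γ * g y))) ≤
      -(γ * ∑ x, g x * q x) + γ ^ 2 / 2 * D ^ 2 := by
    have h1 := Real.log_le_sub_one_of_pos hZ
    have h2 : ∑ y, q y * Real.exp (-(γ * g y)) ≤ ∑ y, q y * (1 - γ * g y + γ ^ 2 / 2 * D ^ 2) :=
      Finset.sum_le_sum fun y _ => mul_le_mul_of_nonneg_left (hexp y) (hq y).le
    have h3 : ∑ y, q y * (1 - γ * g y + γ ^ 2 / 2 * D ^ 2) =
        (∑ y, q y) * (1 + γ ^ 2 / 2 * D ^ 2) - γ * ∑ x, g x * q x := by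
      rw [Finset.sum_mul, Finset.mul_sum, ← Finset.sum_sub_distrib]
      exact Finset.sum_congr rfl fun y _ => by ring
    rw [h3, hq1] at h2
    linarith
  simp only [mul_sub, Finset.sum_sub_distrib]
  linarith

end Update

/-- The regret bound of multiplicative weights, started at the uniform distribution. -/
lemma mw_regret_le [Nonempty X] {γ : ℝ} (hγ : 0 < γ) (K : ℕ) (g q : ℕ → X → ℝ) (D : ℕ → ℝ)
    (hq0 : ∀ x, q 0 x = 1 / (Fintype.card X : ℝ)) (hq : ∀ k < K, q (k + 1) = mwUpdate γ (g k) (q k))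
    (hg : ∀ k ≤ K, ∀ x, 0 ≤ g k x) (hgD : ∀ k ≤ K, ∀ x, g k x ≤ D k)
    {p : X → ℝ} (hp : p ∈ stdSimplex ℝ X) :
    ∑ k ∈ Finset.range (K + 1), ∑ x, g k x * (q k x - p x) ≤
      Real.log (Fintype.card X) / γ + γ / 2 * ∑ k ∈ Finset.range (K + 1), D k ^ 2 := by
  have hc : (0 : ℝ) < Fintype.card X := by exact_mod_cast Fintype.card_pos
  have hpos : ∀ k ≤ K, (∀ x, 0 < q k x) ∧ ∑ x, q k x = 1 := by
    intro k hk
    induction k with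
    | zero =>
      refine ⟨fun x => by rw [hq0]; positivity, ?_⟩
      simp only [hq0, Finset.sum_const, Finset.card_univ, nsmul_eq_mul]
      field_simp
    | succ k ih =>
      rw [hq k hk]
      have := (ih (by omega)).1
      exact ⟨mwUpdate_pos _ _ this, sum_mwUpdate _ _ this⟩
  have hstep : ∀ k ≤ K, γ * ∑ x, g k x * (q k x - p x) ≤
      klDist p (q k) - klDist p (mwUpdate γ (g k) (q k)) + γ ^ 2 / 2 * D k ^ 2 := fun k hk =>
    mwUpdate_step γ (g k) (hpos k hk).1 hγ.le (hpos k hk).2 (hg k hk) (hgD k hk) hp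
  have htel : ∀ n ≤ K, γ * ∑ k ∈ Finset.range (n + 1), ∑ x, g k x * (q k x - p x) ≤
      klDist p (q 0) - klDist p (mwUpdate γ (g n) (q n)) +
        γ ^ 2 / 2 * ∑ k ∈ Finset.range (n + 1), D k ^ 2 := by
    intro n hn
    induction n with
    | zero => simpa using hstep 0 hn
    | succ n ih =>
      rw [Finset.sum_range_succ, Finset.sum_range_succ _ (n + 1), mul_add, mul_add]
      have h1 := ih (by omega)
      have h2 := hstep (n + 1) hn
      rw [← hq n (by omega)] at h1
      linarith
  have h1 := htel K le_rfl
  have h2 : 0 ≤ klDist p (mwUpdate γ (g K) (q K)) :=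
    klDist_nonneg hp (mwUpdate_pos _ _ (hpos K le_rfl).1) (sum_mwUpdate _ _ (hpos K le_rfl).1)
  have h3 : klDist p (q 0) ≤ Real.log (Fintype.card X) := by
    rw [funext hq0]
    exact klDist_uniform_le hp
  rw [div_add' _ _ _ hγ.ne', le_div_iff₀ hγ]
  linarith

end MirrorDescent

section Algorithm

lemma stepSize_pos {S B : Type*} [Fintype S] [Fintype B] [Nonempty S] {K : ℕ} (hK : 1 ≤ K) (hB : 2 ≤ Fintype.card B) :
    0 < stepSize S B K := by
  have h1 : (0 : ℝ) < Fintype.card S := by exact_mod_cast Fintype.card_pos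
  have h2 : 0 < Real.log (Fintype.card B) := Real.log_pos (by exact_mod_cast hB)
  have h3 : (0 : ℝ) < K := by exact_mod_cast hK
  exact Real.sqrt_pos.2 (by positivity)

variable {S A B : Type*} [Fintype S] [DecidableEq S] [Fintype A] [DecidableEq A]
  [Fintype B] [DecidableEq B] {H : ℕ}

/-- The loss of Player 2's action `b` at `(h, s)` in the mirror descent step after episode `k`. -/
noncomputable def mdLoss (s₁ : S) (K : ℕ) (δ : ℝ) (t : ℕ → Traj S A B H)
    (R : ℕ → Fin H → ℝ) (k : ℕ) (μ : Policy S A H) (h : Fin H) (s : S) (b : B) : ℝ :=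
  reach s₁ μ (pHat t k) h.castSucc s * ∑ a : A, μ h s a * rTilde K δ t R k h s a b

lemma rTilde_zero (K : ℕ) (δ : ℝ) (t : ℕ → Traj S A B H) (R : ℕ → Fin H → ℝ)
    (h : Fin H) (s : S) (a : A) (b : B) : rTilde K δ t R 0 h s a b = 0 := by
  simp [rTilde, rHat, bonus]

lemma mdLoss_zero (s₁ : S) (K : ℕ) (δ : ℝ) (t : ℕ → Traj S A B H)
    (R : ℕ → Fin H → ℝ) (μ : Policy S A H) (h : Fin H) (s : S) (b : B) :
    mdLoss s₁ K δ t R 0 μ h s b = 0 := by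
  simp [mdLoss, rTilde_zero]

/-- The solution of the mirror descent problem is the multiplicative weights update. -/
lemma eq_mwUpdate_of_isMinOn [Nonempty S] [Nonempty B] {s₁ : S} {K : ℕ} (hK : 1 ≤ K)
    (hB : 2 ≤ Fintype.card B) {δ : ℝ} {t : ℕ → Traj S A B H} {R : ℕ → Fin H → ℝ} {k : ℕ}
    {μ : Policy S A H} {ν ν' : Policy S B H} (hν : ∀ h s b, 0 < ν h s b)
    (hν' : IsPolicy ν') (s : S)
    (hmin : IsMinOn (objective s₁ K δ t R k μ ν s) {π | IsPolicy π} ν') (h : Fin H) :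
    ν' h s = mwUpdate (stepSize S B K) (mdLoss s₁ K δ t R k μ h s) (ν h s) := by
  set γ := stepSize S B K with hγdef
  have hγ : 0 < γ := stepSize_pos hK hB
  set u : Policy S B H := fun h s => mwUpdate γ (mdLoss s₁ K δ t R k μ h s) (ν h s) with hu
  have hupos : ∀ h s b, 0 < u h s b := fun h s => mwUpdate_pos _ _ (hν h s)
  have husum : ∀ h s, ∑ b, u h s b = 1 := fun h s => sum_mwUpdate _ _ (hν h s)
  have hupol : IsPolicy u := fun h s => ⟨fun b => (hupos h s b).le, husum h s⟩
  have hobj : ∀ π : Policy S B H, IsPolicy π → objective s₁ K δ t R k μ ν s π =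
      ∑ h, (γ⁻¹ * klDist (π h s) (u h s) -
        (γ⁻¹ * Real.log (∑ b, ν h s b * Real.exp (-(γ * mdLoss s₁ K δ t R k μ h s b))) +
          ∑ b, mdLoss s₁ K δ t R k μ h s b * ν h s b)) := by
    intro π hπ
    refine Finset.sum_congr rfl fun h _ => ?_
    have h1 := klDist_add_eq γ (mdLoss s₁ K δ t R k μ h s) (hν h s) (hπ h s)
    have h2 : reach s₁ μ (pHat t k) h.castSucc s *
        (∑ a : A, ∑ b : B, μ h s a * rTilde K δ t R k h s a b * (π h s b - ν h s b)) =
        ∑ b, mdLoss s₁ K δ t R k μ h s b * π h s b - ∑ b, mdLoss s₁ K δ t R k μ h s b * ν h s b := by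
      rw [Finset.sum_comm, ← Finset.sum_sub_distrib, Finset.mul_sum]
      refine Finset.sum_congr rfl fun b _ => ?_
      rw [← Finset.sum_mul, mdLoss]
      ring
    have h3 : klDist (π h s) (u h s) = γ * ∑ b, mdLoss s₁ K δ t R k μ h s b * π h s b +
        klDist (π h s) (ν h s) +
        Real.log (∑ b, ν h s b * Real.exp (-(γ * mdLoss s₁ K δ t R k μ h s b))) := by
      rw [h1]; simp only [hu]; ring
    rw [h2, h3, ← hγdef]
    field_simp
    ring
  have hle : objective s₁ K δ t R k μ ν s ν' ≤ objective s₁ K δ t R k μ ν s u := hmin hupol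
  rw [hobj _ hν', hobj _ hupol, Finset.sum_sub_distrib, Finset.sum_sub_distrib,
    sub_le_sub_iff_right, ← Finset.mul_sum, ← Finset.mul_sum, mul_le_mul_iff_right₀ (inv_pos.2 hγ),
    Finset.sum_eq_zero (fun h _ => klDist_self (hupos h s))] at hle
  have h0 : ∀ h ∈ Finset.univ, 0 ≤ klDist (ν' h s) (u h s) := fun h _ =>
    klDist_nonneg (hν' h s) (hupos h s) (husum h s)
  have h1 := (Finset.sum_eq_zero_iff_of_nonneg h0).1 (le_antisymm hle (Finset.sum_nonneg h0)) h
    (Finset.mem_univ h)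
  exact eq_of_klDist_nonpos (hν' h s) (hupos h s) (husum h s) h1.le

/-- Player 2's policies are the multiplicative weights iterates for the losses `mdLoss`. -/
lemma RunsAlgorithm.eq_mwUpdate [Nonempty S] [Nonempty B] {s₁ : S} {K : ℕ} (hK : 1 ≤ K)
    (hB : 2 ≤ Fintype.card B) {δ : ℝ} {t : ℕ → Traj S A B H} {R : ℕ → Fin H → ℝ}
    {μ : ℕ → Policy S A H} {ν : ℕ → Policy S B H} (hrun : RunsAlgorithm s₁ K δ t R μ ν)
    {k : ℕ} (hk : k < K) (h : Fin H) (s : S) :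
    ν (k + 1) h s = mwUpdate (stepSize S B K) (mdLoss s₁ K δ t R k (μ k) h s) (ν k h s) := by
  have hc : (0 : ℝ) < Fintype.card B := by exact_mod_cast Fintype.card_pos
  have hpos : ∀ j ≤ k, ∀ h s b, 0 < ν j h s b := by
    intro j hj
    induction j with
    | zero => intro h s b; rw [hrun.1]; positivity
    | succ j ih =>
      intro h s b
      obtain ⟨hpol, hmin⟩ := hrun.2 j (by omega)
      rw [eq_mwUpdate_of_isMinOn hK hB (ih (by omega)) hpol s (hmin s) h]
      exact mwUpdate_pos _ _ (ih (by omega) h s) b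
  obtain ⟨hpol, hmin⟩ := hrun.2 k hk
  exact eq_mwUpdate_of_isMinOn hK hB (hpos k le_rfl) hpol s (hmin s) h

end Algorithm

/-! ### Sums of inverse square roots of visit counts -/

section Counting

variable {X : Type*} [Fintype X] [DecidableEq X]

lemma one_div_sqrt_max_le (n : ℕ) :
    1 / √(max (n : ℝ) 1) ≤ 3 * (√((n : ℝ) + 1) - √(n : ℝ)) := by
  have hm : (1 : ℝ) ≤ max (n : ℝ) 1 := le_max_right _ _
  set m := max (n : ℝ) 1 with hmdef
  have hn0 : (0 : ℝ) ≤ n := Nat.cast_nonneg n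
  have h1 : (n : ℝ) + 1 ≤ (3 / 2 * √m) ^ 2 := by
    rw [mul_pow, Real.sq_sqrt (by linarith)]
    rcases n.eq_zero_or_pos with h | h
    · simp only [h, Nat.cast_zero, zero_add]; nlinarith
    · have : (1 : ℝ) ≤ n := by exact_mod_cast h
      have h2 : m = n := max_eq_left this
      rw [h2]; linarith
  have hs : 0 < √m := Real.sqrt_pos.2 (by linarith)
  have h2 : √((n : ℝ) + 1) ≤ 3 / 2 * √m := (Real.sqrt_le_left (by positivity)).2 h1
  have h3 : √(n : ℝ) ≤ 3 / 2 * √m :=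
    (Real.sqrt_le_sqrt (by linarith)).trans h2
  have h4 : (√((n : ℝ) + 1) - √(n : ℝ)) * (√((n : ℝ) + 1) + √(n : ℝ)) = 1 := by
    ring_nf
    rw [Real.sq_sqrt (by positivity), Real.sq_sqrt hn0]; ring
  have h5 : 0 ≤ √((n : ℝ) + 1) - √(n : ℝ) :=
    sub_nonneg.2 (Real.sqrt_le_sqrt (by linarith))
  rw [div_le_iff₀ hs]
  nlinarith

/-- The sum over `k` of `N^{-1/2}`, where `N` counts the earlier visits to the current point, is
`O(√(|X| K))`. -/
lemma sum_one_div_sqrt_visits_le (x : ℕ → X) (K : ℕ) :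
    ∑ k ∈ Finset.range K,
      1 / √(max ((((Finset.Icc 1 k).filter (fun τ => x τ = x (k + 1))).card : ℕ) : ℝ) 1) ≤
      3 * √((Fintype.card X : ℝ) * K) := by
  set N : ℕ → X → ℕ := fun k y => ((Finset.Icc 1 k).filter (fun τ => x τ = y)).card with hN
  have hNs : ∀ k y, N (k + 1) y = N k y + if x (k + 1) = y then 1 else 0 := by
    intro k y
    simp only [hN]
    rw [← Finset.insert_Icc_right_eq_Icc_add_one (by omega), Finset.filter_insert]
    split_ifs with h
    · rw [Finset.card_insert_of_notMem (by simp)]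
    · rfl
  have h1 : ∀ K, ∑ k ∈ Finset.range K, 1 / √(max (N k (x (k + 1)) : ℝ) 1) ≤
      3 * ∑ y, √(N K y : ℝ) := by
    intro K
    induction K with
    | zero => simp [hN]
    | succ K ih =>
      rw [Finset.sum_range_succ]
      have h2 : ∑ y, √(N (K + 1) y : ℝ) = ∑ y, √(N K y : ℝ) +
          (√((N K (x (K + 1)) : ℝ) + 1) - √(N K (x (K + 1)) : ℝ)) := by
        rw [← sub_eq_iff_eq_add', ← Finset.sum_sub_distrib, Finset.sum_eq_single (x (K + 1))]
        · rw [hNs]; simp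
        · intro y _ hy; rw [hNs, if_neg (Ne.symm hy)]; simp
        · simp
      rw [h2, mul_add]
      exact add_le_add ih (one_div_sqrt_max_le _)
  have h3 : ∀ K, ∑ y, N K y = K := by
    intro K
    induction K with
    | zero => simp [hN]
    | succ K ih => simp only [hNs, Finset.sum_add_distrib, ih]; simp
  refine (h1 K).trans (mul_le_mul_of_nonneg_left ?_ (by norm_num))
  refine Real.le_sqrt_of_sq_le ?_
  have h4 := sq_sum_le_card_mul_sum_sq (s := (Finset.univ : Finset X)) (f := fun y => √(N K y : ℝ))
  simp only [Real.sq_sqrt (Nat.cast_nonneg _), ← Nat.cast_sum, h3, Finset.card_univ] at h4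
  exact h4

end Counting

/-! ### A self-normalized Hoeffding inequality for martingale differences -/

section Concentration

/-- If `X` vanishes off an event with indicator `c` and is bounded by `1` there, then
`exp (θ X - θ² c / 2)` lies below an affine function of `X` with value `1` at `0`. -/
lemma exp_sub_le_one_add (θ x : ℝ) {c : ℕ} (hc : c ≤ 1) (hx : |x| ≤ c) :
    Real.exp (θ * x - θ ^ 2 / 2 * c) ≤ 1 + Real.exp (-(θ ^ 2 / 2)) * Real.sinh θ * x := by
  interval_cases c
  · have : x = 0 := by simpa using hx
    simp [this]
  · have h1 := Real.exp_mul_le_cosh_add_mul_sinh (by simpa using hx) θ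
    have h2 := Real.cosh_le_exp_half_sq θ
    have h3 : Real.exp (-(θ ^ 2 / 2)) * Real.exp (θ ^ 2 / 2) = 1 := by
      rw [← Real.exp_add]; simp
    calc Real.exp (θ * x - θ ^ 2 / 2 * (1 : ℕ))
        = Real.exp (-(θ ^ 2 / 2)) * Real.exp (x * θ) := by
          rw [← Real.exp_add]; congr 1; push_cast; ring
      _ ≤ Real.exp (-(θ ^ 2 / 2)) * (Real.exp (θ ^ 2 / 2) + x * Real.sinh θ) :=
          mul_le_mul_of_nonneg_left (by linarith) (Real.exp_pos _).le
      _ = _ := by rw [mul_add, h3]; ring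

variable {Ω : Type*} {mΩ : MeasurableSpace Ω} {Pr : Measure Ω} [IsProbabilityMeasure Pr]

lemma integral_mul_eq_zero_of_condExp {m : MeasurableSpace Ω} (hm : m ≤ mΩ) {Z X : Ω → ℝ}
    (hZ : StronglyMeasurable[m] Z) (hX : Integrable X Pr) (hZX : Integrable (fun ω => Z ω * X ω) Pr)
    (h0 : Pr[X | m] =ᵐ[Pr] 0) : ∫ ω, Z ω * X ω ∂Pr = 0 := by
  rw [← integral_condExp hm]
  have h1 : Pr[fun ω => Z ω * X ω | m] =ᵐ[Pr] 0 := by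
    refine (condExp_mul_of_stronglyMeasurable_left hZ hZX hX).trans ?_
    filter_upwards [h0] with ω hω
    simp [hω]
  rw [integral_congr_ae h1]
  simp

variable {ℱ : Filtration ℕ mΩ} {K : ℕ} {X : ℕ → Ω → ℝ} {c : ℕ → Ω → ℕ}

/-- The exponential supermartingale. The indicators `c k` need not be predictable. -/
lemma integral_exp_sub_le_one (hX : ∀ k < K, StronglyMeasurable[ℱ (k + 1)] (X k))
    (hc : ∀ k < K, Measurable[ℱ (k + 1)] (c k)) (hc1 : ∀ k < K, ∀ ω, c k ω ≤ 1)
    (hXc : ∀ k < K, ∀ᵐ ω ∂Pr, |X k ω| ≤ c k ω)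
    (h0 : ∀ k < K, Pr[X k | ℱ k] =ᵐ[Pr] 0) (θ : ℝ) (n : ℕ) (hn : n ≤ K) :
    Integrable (fun ω => Real.exp (θ * ∑ k ∈ Finset.range n, X k ω -
        θ ^ 2 / 2 * (∑ k ∈ Finset.range n, c k ω : ℕ))) Pr ∧
      ∫ ω, Real.exp (θ * ∑ k ∈ Finset.range n, X k ω -
        θ ^ 2 / 2 * (∑ k ∈ Finset.range n, c k ω : ℕ)) ∂Pr ≤ 1 := by
  set M : ℕ → Ω → ℝ := fun n ω => Real.exp (θ * ∑ k ∈ Finset.range n, X k ω -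
        θ ^ 2 / 2 * (∑ k ∈ Finset.range n, c k ω : ℕ)) with hM
  have hmeas : ∀ n ≤ K, StronglyMeasurable[ℱ n] (M n) := by
    intro n hn
    have h1 : Measurable[ℱ n] (fun ω => ∑ k ∈ Finset.range n, X k ω) :=
      Finset.measurable_fun_sum _ fun k hk => by
        have := Finset.mem_range.1 hk
        exact ((hX k (by omega)).mono (ℱ.mono (by omega))).measurable
    have h2 : Measurable[ℱ n] (fun ω => ∑ k ∈ Finset.range n, c k ω) :=
      Finset.measurable_fun_sum _ fun k hk => by
        have := Finset.mem_range.1 hk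
        exact (hc k (by omega)).mono (ℱ.mono (by omega)) le_rfl
    have h3 : Measurable[ℱ n] (fun ω => ((∑ k ∈ Finset.range n, c k ω : ℕ) : ℝ)) :=
      (measurable_from_top (f := fun m : ℕ => (m : ℝ))).comp h2
    exact (Real.measurable_exp.comp ((h1.const_mul θ).sub (h3.const_mul _))).stronglyMeasurable
  have hall : ∀ᵐ ω ∂Pr, ∀ k < K, |X k ω| ≤ c k ω := by
    rw [ae_all_iff]; intro k
    by_cases hk : k < K
    · filter_upwards [hXc k hk] with ω h _ using h
    · exact Filter.Eventually.of_forall fun ω h => absurd h hk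
  have hbd : ∀ n ≤ K, ∀ᵐ ω ∂Pr, ‖M n ω‖ ≤ Real.exp (|θ| * n) := by
    intro n hn
    filter_upwards [hall] with ω hω
    rw [Real.norm_of_nonneg (Real.exp_pos _).le, Real.exp_le_exp]
    have h1 : |∑ k ∈ Finset.range n, X k ω| ≤ n := by
      refine (Finset.abs_sum_le_sum_abs _ _).trans ?_
      calc ∑ k ∈ Finset.range n, |X k ω| ≤ ∑ k ∈ Finset.range n, 1 := by
            refine Finset.sum_le_sum fun k hk => ?_
            have hk' : k < K := by have := Finset.mem_range.1 hk; omega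
            exact (hω k hk').trans (by exact_mod_cast hc1 k hk' ω)
        _ = n := by simp
    have h2 : θ * ∑ k ∈ Finset.range n, X k ω ≤ |θ| * n := by
      refine (le_abs_self _).trans ?_
      rw [abs_mul]
      exact mul_le_mul_of_nonneg_left h1 (abs_nonneg _)
    have h3 : 0 ≤ θ ^ 2 / 2 * ((∑ k ∈ Finset.range n, c k ω : ℕ) : ℝ) := by positivity
    linarith
  have hint : ∀ n ≤ K, Integrable (M n) Pr := fun n hn =>
    Integrable.of_bound ((hmeas n hn).mono (ℱ.le n)).aestronglyMeasurable _ (hbd n hn)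
  refine ⟨hint n hn, ?_⟩
  induction n with
  | zero => simp
  | succ n ih =>
    have hn' : n < K := hn
    have hXb : ∀ᵐ ω ∂Pr, ‖X n ω‖ ≤ 1 := by
      filter_upwards [hall] with ω hω
      exact (hω n hn').trans (by exact_mod_cast hc1 n hn' ω)
    have hXm : AEStronglyMeasurable (X n) Pr :=
      ((hX n hn').mono (ℱ.le _)).aestronglyMeasurable
    have hXi : Integrable (X n) Pr := Integrable.of_bound hXm 1 hXb
    have hMX : Integrable (fun ω => M n ω * X n ω) Pr := (hint n hn'.le).mul_bdd hXm hXb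
    have hz := integral_mul_eq_zero_of_condExp (ℱ.le n) (hmeas n hn'.le) hXi hMX (h0 n hn')
    set κ := Real.exp (-(θ ^ 2 / 2)) * Real.sinh θ
    calc ∫ ω, M (n + 1) ω ∂Pr ≤ ∫ ω, (M n ω + κ * (M n ω * X n ω)) ∂Pr := by
          refine integral_mono_ae (hint _ hn) ((hint n hn'.le).add (hMX.const_mul κ)) ?_
          filter_upwards [hall] with ω hω
          have h1 := exp_sub_le_one_add θ (X n ω) (hc1 n hn' ω) (hω n hn')
          have h2 : M (n + 1) ω = M n ω * Real.exp (θ * X n ω - θ ^ 2 / 2 * c n ω) := by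
            simp only [hM]
            rw [← Real.exp_add, Finset.sum_range_succ, Finset.sum_range_succ]
            congr 1; push_cast; ring
          rw [h2]
          refine (mul_le_mul_of_nonneg_left h1 (Real.exp_pos _).le).trans (le_of_eq ?_)
          ring
      _ = ∫ ω, M n ω ∂Pr := by
          rw [integral_add (hint n hn'.le) (hMX.const_mul κ), integral_const_mul, hz]; ring
      _ ≤ 1 := ih hn'.le

/-- The deviation is normalized by the random number of times at which `c k = 1`; the factor `K`
comes from a union bound over the values of that number. -/
lemma measureReal_sqrt_lt_sum_le (hX : ∀ k < K, StronglyMeasurable[ℱ (k + 1)] (X k))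
    (hc : ∀ k < K, Measurable[ℱ (k + 1)] (c k)) (hc1 : ∀ k < K, ∀ ω, c k ω ≤ 1)
    (hXc : ∀ k < K, ∀ᵐ ω ∂Pr, |X k ω| ≤ c k ω)
    (h0 : ∀ k < K, Pr[X k | ℱ k] =ᵐ[Pr] 0) {E : ℝ} (hE : 0 ≤ E) {n : ℕ} (hn : n ≤ K) :
    Pr.real {ω | √(2 * E * (∑ k ∈ Finset.range n, c k ω : ℕ)) < ∑ k ∈ Finset.range n, X k ω} ≤
      K * Real.exp (-E) := by
  set N : Ω → ℕ := fun ω => ∑ k ∈ Finset.range n, c k ω with hN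
  set T : Ω → ℝ := fun ω => ∑ k ∈ Finset.range n, X k ω with hT
  have hmar : ∀ θ : ℝ,
      Pr.real {ω | Real.exp E ≤ Real.exp (θ * T ω - θ ^ 2 / 2 * N ω)} ≤ Real.exp (-E) := by
    intro θ
    obtain ⟨hi, hle⟩ := integral_exp_sub_le_one hX hc hc1 hXc h0 θ n hn
    have h1 := mul_meas_ge_le_integral_of_nonneg (μ := Pr)
      (Filter.Eventually.of_forall fun ω => (Real.exp_pos _).le) hi (Real.exp E)
    rw [Real.exp_neg, ← one_div, le_div_iff₀' (Real.exp_pos _)]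
    exact h1.trans hle
  have hall : ∀ᵐ ω ∂Pr, ∀ k < K, |X k ω| ≤ c k ω := by
    rw [ae_all_iff]; intro k
    by_cases hk : k < K
    · filter_upwards [hXc k hk] with ω h _ using h
    · exact Filter.Eventually.of_forall fun ω h => absurd h hk
  have hsub : {ω | √(2 * E * (N ω : ℝ)) < T ω} ≤ᵐ[Pr] ⋃ m ∈ Finset.Icc 1 K,
      {ω | Real.exp E ≤ Real.exp (√(2 * E / (m : ℝ)) * T ω - √(2 * E / (m : ℝ)) ^ 2 / 2 * N ω)} := by
    filter_upwards [hall] with ω hω hlt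
    replace hlt : √(2 * E * (N ω : ℝ)) < T ω := hlt
    have hNK : N ω ≤ K := by
      calc N ω ≤ ∑ k ∈ Finset.range n, 1 := Finset.sum_le_sum fun k hk => by
            have := Finset.mem_range.1 hk; exact hc1 k (by omega) ω
        _ ≤ K := by simpa using hn
    have hTN : T ω ≤ N ω := by
      simp only [hT, hN, Nat.cast_sum]
      refine Finset.sum_le_sum fun k hk => (le_abs_self _).trans ?_
      have := Finset.mem_range.1 hk; exact hω k (by omega)
    have hN1 : 1 ≤ N ω := by
      by_contra hcon
      have hz : N ω = 0 := by omega
      rw [hz] at hTN hlt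
      simp only [Nat.cast_zero, mul_zero, Real.sqrt_zero] at hTN hlt
      linarith
    have hmem : ω ∈ ⋃ m ∈ Finset.Icc 1 K, {ω | Real.exp E ≤
        Real.exp (√(2 * E / (m : ℝ)) * T ω - √(2 * E / (m : ℝ)) ^ 2 / 2 * N ω)} := by
      refine Set.mem_biUnion (Finset.mem_coe.2 (Finset.mem_Icc.2 ⟨hN1, hNK⟩)) ?_
      have hp : (0 : ℝ) < N ω := by exact_mod_cast hN1
      rw [Set.mem_ofPred_eq, Real.exp_le_exp, Real.sq_sqrt (by positivity)]
      have h1 : √(2 * E / (N ω : ℝ)) * √(2 * E * (N ω : ℝ)) = 2 * E := by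
        rw [← Real.sqrt_mul (by positivity)]
        have : 2 * E / (N ω : ℝ) * (2 * E * (N ω : ℝ)) = (2 * E) ^ 2 := by field_simp
        rw [this, Real.sqrt_sq (by positivity)]
      have h2 : √(2 * E / (N ω : ℝ)) * √(2 * E * (N ω : ℝ)) ≤ √(2 * E / (N ω : ℝ)) * T ω :=
        mul_le_mul_of_nonneg_left hlt.le (Real.sqrt_nonneg _)
      have h3 : 2 * E / (N ω : ℝ) / 2 * N ω = E := by field_simp
      linarith
    exact hmem
  calc Pr.real {ω | √(2 * E * (N ω : ℝ)) < T ω} ≤ Pr.real (⋃ m ∈ Finset.Icc 1 K,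
      {ω | Real.exp E ≤ Real.exp (√(2 * E / (m : ℝ)) * T ω - √(2 * E / (m : ℝ)) ^ 2 / 2 * N ω)}) :=
        ENNReal.toReal_mono (measure_ne_top _ _) (measure_mono_ae hsub)
    _ ≤ ∑ m ∈ Finset.Icc 1 K, Real.exp (-E) :=
        (measureReal_biUnion_finset_le _ _).trans (Finset.sum_le_sum fun m _ => hmar _)
    _ = K * Real.exp (-E) := by simp

end Concentration

/-! ### Concentration along the play -/

section Play

/-- The sign vector of a set of states. -/
def signVec {S : Type*} [DecidableEq S] (W : Finset S) (s : S) : ℝ := if s ∈ W then 1 else -1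

lemma abs_signVec {S : Type*} [DecidableEq S] (W : Finset S) (s : S) : |signVec W s| = 1 := by
  unfold signVec; split_ifs <;> simp

variable {S A B : Type*} [Fintype S] [DecidableEq S] [Fintype A] [Fintype B] {H : ℕ} {Ω : Type*} {mΩ : MeasurableSpace Ω} {G : Game S A B H}
  {K : ℕ} {Pr : Measure Ω} {ℱ : Filtration ℕ mΩ}
  {μ : ℕ → Ω → Policy S A H} {ν : ℕ → Ω → Policy S B H}
  {t : ℕ → Ω → Traj S A B H} {R : ℕ → Ω → Fin H → ℝ}

lemma sum_Icc_one_eq_sum_range {M : Type*} [AddCommMonoid M] (f : ℕ → M) (n : ℕ) :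
    ∑ τ ∈ Finset.Icc 1 n, f τ = ∑ k ∈ Finset.range n, f (k + 1) := by
  induction n with
  | zero => simp
  | succ n ih => rw [Finset.sum_Icc_succ_top (by omega), ih, Finset.sum_range_succ]

lemma IsPlay.measurable_comp_traj (hp : IsPlay G K Pr ℱ μ ν t R) {β : Type*} [MeasurableSpace β]
    (f : Traj S A B H → β) {k : ℕ} (hk : k < K) :
    Measurable[ℱ (k + 1)] (fun ω => f (t (k + 1) ω)) := by
  let _ : MeasurableSpace (Traj S A B H) := ⊤
  have h1 : Measurable[ℱ (k + 1)] (t (k + 1)) := by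
    refine @measurable_to_countable' _ _ _ _ (ℱ (k + 1)) _ fun x => ?_
    exact hp.traj_meas k hk x
  exact (measurable_from_top (f := f)).comp h1

lemma IsPlay.measurable_visits (hp : IsPlay G K Pr ℱ μ ν t R) {X : Type*} [DecidableEq X]
    (φ : Traj S A B H → X) (y : X) {k : ℕ} (hk : k ≤ K) :
    Measurable[ℱ k] (fun ω => ((Finset.Icc 1 k).filter (fun τ => φ (t τ ω) = y)).card) := by
  simp only [Finset.card_filter, sum_Icc_one_eq_sum_range]
  refine Finset.measurable_fun_sum _ fun i hi => ?_
  have := Finset.mem_range.1 hi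
  exact (hp.measurable_comp_traj (fun x => if φ x = y then 1 else 0) (by omega)).mono
    (ℱ.mono (by omega)) le_rfl

variable [IsProbabilityMeasure Pr]

/-- The conditional expectation of a predictable function of the next trajectory. No measurability
of Player 2's policy is needed. -/
lemma IsPlay.condExp_comp_traj (hp : IsPlay G K Pr ℱ μ ν t R) {k : ℕ} (hk : k < K)
    (g : Ω → Traj S A B H → ℝ) (hg : ∀ x, Measurable[ℱ k] (fun ω => g ω x))
    (hg1 : ∀ ω x, |g ω x| ≤ 1) :
    Pr[fun ω => g ω (t (k + 1) ω) | ℱ k] =ᵐ[Pr]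
      fun ω => ∑ x, trajProb G (μ (k + 1) ω) (ν (k + 1) ω) x * g ω x := by
  have hind : ∀ x, Integrable (Set.indicator {ω | t (k + 1) ω = x} (fun _ => (1 : ℝ))) Pr :=
    fun x => (integrable_const 1).indicator (ℱ.le _ _ (hp.traj_meas k hk x))
  have hgi : ∀ x, Integrable ((fun ω => g ω x) *
      Set.indicator {ω | t (k + 1) ω = x} (fun _ => (1 : ℝ))) Pr := fun x =>
    (hind x).bdd_mul ((hg x).mono (ℱ.le k) le_rfl).aestronglyMeasurable
      (Filter.Eventually.of_forall fun ω => hg1 ω x)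
  have hsum : (fun ω => g ω (t (k + 1) ω)) = ∑ x, ((fun ω => g ω x) *
      Set.indicator {ω | t (k + 1) ω = x} (fun _ => (1 : ℝ))) := by
    classical
    funext ω
    simp [Finset.sum_apply, Set.indicator_apply]
  rw [hsum]
  refine (condExp_finsetSum (fun x _ => hgi x) _).trans ?_
  have hall : ∀ᵐ ω ∂Pr, ∀ x, Pr[(fun ω => g ω x) *
      Set.indicator {ω | t (k + 1) ω = x} (fun _ => (1 : ℝ)) | ℱ k] ω =
        trajProb G (μ (k + 1) ω) (ν (k + 1) ω) x * g ω x := by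
    rw [ae_all_iff]
    intro x
    filter_upwards [condExp_mul_of_stronglyMeasurable_left (hg x).stronglyMeasurable (hgi x)
      (hind x), hp.traj_law k hk x] with ω h1 h2
    rw [h1, Pi.mul_apply, h2, mul_comm]
  filter_upwards [hall] with ω hω
  simp [Finset.sum_apply, hω]

/-- The deviation of the empirical from the expected visit-weighted sums. -/
lemma IsPlay.measureReal_visits_le (hp : IsPlay G K Pr ℱ μ ν t R)
    (hν : ∀ k < K, ∀ ω, IsPolicy (ν (k + 1) ω)) {X : Type*} [Fintype X] [DecidableEq X]
    (φ : Traj S A B H → X) {E : ℝ} (hE : 0 ≤ E) :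
    Pr.real {ω | 3 * √((Fintype.card X : ℝ) * K) + √(2 * E * K) <
      ∑ k ∈ Finset.range K, ∑ x, trajProb G (μ (k + 1) ω) (ν (k + 1) ω) x *
        (1 / √(max ((((Finset.Icc 1 k).filter (fun τ => φ (t τ ω) = φ x)).card : ℕ) : ℝ) 1))} ≤
      K * Real.exp (-E) := by
  classical
  set g : ℕ → Ω → Traj S A B H → ℝ := fun k ω x =>
    1 / √(max ((((Finset.Icc 1 k).filter (fun τ => φ (t τ ω) = φ x)).card : ℕ) : ℝ) 1) with hg
  have hg0 : ∀ k ω x, 0 ≤ g k ω x := fun k ω x => by positivity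
  have hg1 : ∀ k ω x, g k ω x ≤ 1 := fun k ω x => by
    have h1 : 1 ≤ √(max ((((Finset.Icc 1 k).filter (fun τ => φ (t τ ω) = φ x)).card : ℕ) : ℝ) 1) :=
      Real.one_le_sqrt.2 (le_max_right _ _)
    exact (div_le_one (by linarith)).2 h1
  have hgm : ∀ k ≤ K, ∀ x, Measurable[ℱ k] (fun ω => g k ω x) := fun k hk x =>
    (measurable_from_top (f := fun m : ℕ => 1 / √(max (m : ℝ) 1))).comp
      (hp.measurable_visits φ (φ x) hk)
  have hgt : ∀ k < K, Measurable[ℱ (k + 1)] (fun ω => g k ω (t (k + 1) ω)) := by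
    intro k hk
    have hsum : (fun ω => g k ω (t (k + 1) ω)) =
        fun ω => ∑ x, g k ω x * (if t (k + 1) ω = x then 1 else 0) := by
      funext ω; simp
    rw [hsum]
    refine Finset.measurable_fun_sum _ fun x _ => ?_
    exact ((hgm k hk.le x).mono (ℱ.mono (by omega)) le_rfl).mul
      (hp.measurable_comp_traj (fun y => if y = x then (1 : ℝ) else 0) hk)
  have hgi : ∀ k < K, Integrable (fun ω => g k ω (t (k + 1) ω)) Pr := fun k hk =>
    Integrable.of_bound ((hgt k hk).mono (ℱ.le _) le_rfl).aestronglyMeasurable 1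
      (Filter.Eventually.of_forall fun ω => by
        rw [Real.norm_of_nonneg (hg0 _ _ _)]; exact hg1 _ _ _)
  have hce : ∀ k < K, Pr[fun ω => g k ω (t (k + 1) ω) | ℱ k] =ᵐ[Pr]
      fun ω => ∑ x, trajProb G (μ (k + 1) ω) (ν (k + 1) ω) x * g k ω x := fun k hk =>
    hp.condExp_comp_traj hk (g k) (hgm k hk.le)
      (fun ω x => by rw [abs_of_nonneg (hg0 _ _ _)]; exact hg1 _ _ _)
  set X' : ℕ → Ω → ℝ := fun k ω =>
    Pr[fun ω => g k ω (t (k + 1) ω) | ℱ k] ω - g k ω (t (k + 1) ω) with hX'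
  have hmain := measureReal_sqrt_lt_sum_le (Pr := Pr) (ℱ := ℱ) (K := K) (X := X')
    (c := fun _ _ => 1) ?_ ?_ ?_ ?_ ?_ hE le_rfl
  · refine le_trans (ENNReal.toReal_mono (measure_ne_top _ _) (measure_mono_ae ?_)) hmain
    have hall : ∀ᵐ ω ∂Pr, ∀ k < K, Pr[fun ω => g k ω (t (k + 1) ω) | ℱ k] ω =
        ∑ x, trajProb G (μ (k + 1) ω) (ν (k + 1) ω) x * g k ω x := by
      rw [ae_all_iff]; intro k
      by_cases hk : k < K
      · filter_upwards [hce k hk] with ω h _ using h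
      · exact Filter.Eventually.of_forall fun ω h => absurd h hk
    filter_upwards [hall] with ω hω hlt
    have h1 : 3 * √((Fintype.card X : ℝ) * K) + √(2 * E * K) <
      ∑ k ∈ Finset.range K, ∑ x, trajProb G (μ (k + 1) ω) (ν (k + 1) ω) x * g k ω x := hlt
    have h2 : ∑ k ∈ Finset.range K, g k ω (t (k + 1) ω) ≤ 3 * √((Fintype.card X : ℝ) * K) :=
      sum_one_div_sqrt_visits_le (fun τ => φ (t τ ω)) K
    have h3 : ∑ k ∈ Finset.range K, X' k ω =
        ∑ k ∈ Finset.range K, ∑ x, trajProb G (μ (k + 1) ω) (ν (k + 1) ω) x * g k ω x -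
          ∑ k ∈ Finset.range K, g k ω (t (k + 1) ω) := by
      rw [← Finset.sum_sub_distrib]
      exact Finset.sum_congr rfl fun k hk => by simp only [hX']; rw [hω k (Finset.mem_range.1 hk)]
    have h4 : √(2 * E * (∑ k ∈ Finset.range K, 1 : ℕ)) < ∑ k ∈ Finset.range K, X' k ω := by
      rw [h3]; simp only [Finset.sum_const, Finset.card_range, smul_eq_mul, mul_one]; linarith
    exact h4
  · intro k hk
    exact (stronglyMeasurable_condExp.mono (ℱ.mono (by omega))).sub (hgt k hk).stronglyMeasurable
  · intro k hk; exact measurable_const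
  · intro k hk ω; exact le_rfl
  · intro k hk
    filter_upwards [hce k hk] with ω hω
    simp only [hX', Nat.cast_one]
    rw [hω]
    have hnn := trajProb_nonneg G (hp.policy₁ k hk ω) (hν k hk ω)
    have h1 : 0 ≤ ∑ x, trajProb G (μ (k + 1) ω) (ν (k + 1) ω) x * g k ω x :=
      Finset.sum_nonneg fun x _ => mul_nonneg (hnn x) (hg0 _ _ _)
    have h2 : ∑ x, trajProb G (μ (k + 1) ω) (ν (k + 1) ω) x * g k ω x ≤ 1 := by
      rw [← sum_trajProb G (hp.policy₁ k hk ω) (hν k hk ω)]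
      exact Finset.sum_le_sum fun x _ => mul_le_of_le_one_right (hnn x) (hg1 _ _ _)
    rw [abs_le]
    constructor <;> linarith [hg0 k ω (t (k + 1) ω), hg1 k ω (t (k + 1) ω)]
  · intro k hk
    have h1 := condExp_sub (m := ℱ k) (μ := Pr)
      (integrable_condExp (m := ℱ k) (f := fun ω => g k ω (t (k + 1) ω))) (hgi k hk)
    refine h1.trans ?_
    rw [condExp_of_stronglyMeasurable (ℱ.le k) stronglyMeasurable_condExp integrable_condExp]
    simp

variable [DecidableEq A]

/-- Concentration of the empirical transitions against a fixed sign vector. -/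
lemma IsPlay.measureReal_transition_le (hp : IsPlay G K Pr ℱ μ ν t R)
    (hν : ∀ k < K, ∀ ω, IsPolicy (ν (k + 1) ω)) (h : Fin H) (s : S) (a : A) (W : Finset S)
    {E : ℝ} (hE : 0 ≤ E) {n : ℕ} (hn : n ≤ K) :
    Pr.real {ω | √(2 * E * (count₂ (fun k => t k ω) n h s a : ℕ)) <
      ∑ τ ∈ Finset.Icc 1 n, if (t τ ω).st h = s ∧ (t τ ω).act₁ h = a then
        (signVec W ((t τ ω).next h) - ∑ s', G.P h s a s' * signVec W s') / 2 else 0} ≤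
      K * Real.exp (-E) := by
  set m := ∑ s', G.P h s a s' * signVec W s' with hm
  have hm1 : |m| ≤ 1 := by
    refine (Finset.abs_sum_le_sum_abs _ _).trans (le_of_eq ?_)
    rw [← (G.P_mem h s a).2]
    exact Finset.sum_congr rfl fun s' _ => by
      rw [abs_mul, abs_signVec, mul_one, abs_of_nonneg ((G.P_mem h s a).1 s')]
  set f : Traj S A B H → ℝ := fun x => if x.st h = s ∧ x.act₁ h = a then
    (signVec W (x.next h) - m) / 2 else 0 with hf
  set c : Traj S A B H → ℕ := fun x => if x.st h = s ∧ x.act₁ h = a then 1 else 0 with hc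
  have hfc : ∀ x, |f x| ≤ c x := by
    intro x
    simp only [hf, hc]
    split_ifs
    · have h1 := abs_le.1 (abs_signVec W (x.next h)).le
      have h2 := abs_le.1 hm1
      rw [abs_le]; constructor <;> push_cast <;> linarith
    · simp
  have hc1 : ∀ x, c x ≤ 1 := fun x => by simp only [hc]; split_ifs <;> simp
  have hmain := measureReal_sqrt_lt_sum_le (Pr := Pr) (ℱ := ℱ) (K := K)
    (X := fun k ω => f (t (k + 1) ω)) (c := fun k ω => c (t (k + 1) ω))
    (fun k hk => (hp.measurable_comp_traj f hk).stronglyMeasurable)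
    (fun k hk => hp.measurable_comp_traj c hk) (fun k hk ω => hc1 _)
    (fun k hk => Filter.Eventually.of_forall fun ω => hfc _) ?_ hE hn
  · simp only [count₂, Finset.card_filter, sum_Icc_one_eq_sum_range]
    exact hmain
  · intro k hk
    refine (hp.condExp_comp_traj hk (fun _ => f) (fun x => measurable_const)
      (fun _ x => (hfc x).trans (by exact_mod_cast hc1 x))).trans ?_
    refine Filter.Eventually.of_forall fun ω => ?_
    have h1 := sum_trajProb_mul_next G (hp.policy₁ k hk ω) (hν k hk ω) h
      (fun s0 a0 s' => if s0 = s ∧ a0 = a then (signVec W s' - m) / 2 else 0)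
    refine h1.trans (Finset.sum_eq_zero fun s0 _ => Finset.sum_eq_zero fun a0 _ => ?_)
    by_cases hsa : s0 = s ∧ a0 = a
    · obtain ⟨rfl, rfl⟩ := hsa
      have h2 : ∑ s', G.P h s0 a0 s' * ((signVec W s' - m) / 2) = 0 := by
        have h3 : ∑ s', G.P h s0 a0 s' * ((signVec W s' - m) / 2) =
            (∑ s', G.P h s0 a0 s' * signVec W s' - (∑ s', G.P h s0 a0 s') * m) / 2 := by
          rw [Finset.sum_mul, ← Finset.sum_sub_distrib, Finset.sum_div]
          exact Finset.sum_congr rfl fun s' _ => by ring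
        rw [h3, (G.P_mem h s0 a0).2, ← hm]; ring
      simp only [and_self, if_true]
      rw [h2, mul_zero]
    · simp [hsa]

variable [DecidableEq B]

/-- Concentration of the empirical rewards, from above (`ε = 1`) and from below (`ε = -1`). -/
lemma IsPlay.measureReal_reward_le (hp : IsPlay G K Pr ℱ μ ν t R) (h : Fin H) (s : S) (a : A)
    (b : B) {ε : ℝ} (hε : |ε| = 1) {E : ℝ} (hE : 0 ≤ E) {n : ℕ} (hn : n ≤ K) :
    Pr.real {ω | √(2 * E * (count₃ (fun k => t k ω) n h s a b : ℕ)) <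
      ∑ τ ∈ Finset.Icc 1 n,
        if (t τ ω).st h = s ∧ (t τ ω).act₁ h = a ∧ (t τ ω).act₂ h = b then
          ε * (R τ ω h - G.r h s a b) else 0} ≤ K * Real.exp (-E) := by
  set f : Traj S A B H → ℝ := fun x =>
    if x.st h = s ∧ x.act₁ h = a ∧ x.act₂ h = b then ε else 0 with hf
  set c : Traj S A B H → ℕ := fun x =>
    if x.st h = s ∧ x.act₁ h = a ∧ x.act₂ h = b then 1 else 0 with hc
  set ρ : Traj S A B H → ℝ := fun x => G.r h (x.st h) (x.act₁ h) (x.act₂ h) with hρ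
  have hc1 : ∀ x, c x ≤ 1 := fun x => by simp only [hc]; split_ifs <;> simp
  have hfc : ∀ x, |f x| = c x := fun x => by simp only [hf, hc]; split_ifs <;> simp [hε]
  have hbd : ∀ k < K, ∀ ω, |R (k + 1) ω h - ρ (t (k + 1) ω)| ≤ 1 := by
    intro k hk ω
    have h1 := hp.reward_mem k hk ω h
    have h2 := G.r_mem h ((t (k + 1) ω).st h) ((t (k + 1) ω).act₁ h) ((t (k + 1) ω).act₂ h)
    rw [abs_le]
    simp only [hρ]
    constructor <;> linarith [h1.1, h1.2, h2.1, h2.2]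
  have hXm : ∀ k < K, Measurable[ℱ (k + 1)] (fun ω => R (k + 1) ω h - ρ (t (k + 1) ω)) :=
    fun k hk => (hp.reward_meas k hk h).sub (hp.measurable_comp_traj ρ hk)
  have hmain := measureReal_sqrt_lt_sum_le (Pr := Pr) (ℱ := ℱ) (K := K)
    (X := fun k ω => f (t (k + 1) ω) * (R (k + 1) ω h - ρ (t (k + 1) ω)))
    (c := fun k ω => c (t (k + 1) ω))
    (fun k hk => ((hp.measurable_comp_traj f hk).mul (hXm k hk)).stronglyMeasurable)
    (fun k hk => hp.measurable_comp_traj c hk) (fun k hk ω => hc1 _)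
    (fun k hk => Filter.Eventually.of_forall fun ω => by
      rw [abs_mul, hfc]
      exact mul_le_of_le_one_right (Nat.cast_nonneg _) (hbd k hk ω)) ?_ hE hn
  · have hset : ∀ ω, (∑ τ ∈ Finset.Icc 1 n,
        if (t τ ω).st h = s ∧ (t τ ω).act₁ h = a ∧ (t τ ω).act₂ h = b then
          ε * (R τ ω h - G.r h s a b) else 0) =
        ∑ k ∈ Finset.range n, f (t (k + 1) ω) * (R (k + 1) ω h - ρ (t (k + 1) ω)) := by
      intro ω
      rw [sum_Icc_one_eq_sum_range]
      refine Finset.sum_congr rfl fun k _ => ?_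
      simp only [hf, hρ]
      split_ifs with hev
      · rw [hev.1, hev.2.1, hev.2.2]
      · simp
    simp only [hset, count₃, Finset.card_filter, sum_Icc_one_eq_sum_range (M := ℕ)]
    exact hmain
  · intro k hk
    let step : Ω → S × A × B :=
      fun ω => ((t (k + 1) ω).st h, (t (k + 1) ω).act₁ h, (t (k + 1) ω).act₂ h)
    set m' : MeasurableSpace Ω := ℱ k ⊔ MeasurableSpace.comap step ⊤ with hm'
    have hle : m' ≤ mΩ := by
      refine sup_le (ℱ.le k) (le_trans ?_ (ℱ.le (k + 1)))
      let _ : MeasurableSpace (S × A × B) := ⊤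
      exact (hp.measurable_comp_traj
        (fun x : Traj S A B H => (x.st h, x.act₁ h, x.act₂ h)) hk).comap_le
    have hstep : ∀ q : S × A × B → ℝ, StronglyMeasurable[m'] (fun ω => q (step ω)) := by
      intro q
      let _ : MeasurableSpace (S × A × B) := ⊤
      have h1 : Measurable[m'] step := Measurable.mono (comap_measurable step) le_sup_right le_rfl
      exact ((measurable_from_top (f := q)).comp h1).stronglyMeasurable
    have hfm : StronglyMeasurable[m'] (fun ω => f (t (k + 1) ω)) :=
      hstep (fun y => if y.1 = s ∧ y.2.1 = a ∧ y.2.2 = b then ε else 0)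
    have hρm : StronglyMeasurable[m'] (fun ω => ρ (t (k + 1) ω)) :=
      hstep (fun y => G.r h y.1 y.2.1 y.2.2)
    have hRi : Integrable (fun ω => R (k + 1) ω h) Pr :=
      Integrable.of_bound ((hp.reward_meas k hk h).mono (ℱ.le _) le_rfl).aestronglyMeasurable 1
        (Filter.Eventually.of_forall fun ω => by
          have h1 := hp.reward_mem k hk ω h
          rw [Real.norm_of_nonneg h1.1]; exact h1.2)
    have hρi : Integrable (fun ω => ρ (t (k + 1) ω)) Pr :=
      Integrable.of_bound (hρm.mono hle).aestronglyMeasurable 1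
        (Filter.Eventually.of_forall fun ω => by
          have h1 := G.r_mem h ((t (k + 1) ω).st h) ((t (k + 1) ω).act₁ h) ((t (k + 1) ω).act₂ h)
          rw [Real.norm_of_nonneg h1.1]; exact h1.2)
    have hDi : Integrable (fun ω => R (k + 1) ω h - ρ (t (k + 1) ω)) Pr := hRi.sub hρi
    have hXi : Integrable ((fun ω => f (t (k + 1) ω)) *
        fun ω => R (k + 1) ω h - ρ (t (k + 1) ω)) Pr :=
      hDi.bdd_mul (c := 1) (hfm.mono hle).aestronglyMeasurable
        (Filter.Eventually.of_forall fun ω => by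
          rw [Real.norm_eq_abs, hfc]; exact_mod_cast hc1 _)
    have hD0 : Pr[fun ω => R (k + 1) ω h - ρ (t (k + 1) ω) | m'] =ᵐ[Pr] 0 := by
      refine (condExp_sub hRi hρi m').trans ?_
      filter_upwards [hp.reward_mean k hk h] with ω hω
      rw [Pi.sub_apply, condExp_of_stronglyMeasurable hle hρm hρi]
      exact sub_eq_zero.2 hω
    have hX0 : Pr[(fun ω => f (t (k + 1) ω)) *
        fun ω => R (k + 1) ω h - ρ (t (k + 1) ω) | m'] =ᵐ[Pr] 0 := by
      refine (condExp_mul_of_stronglyMeasurable_left hfm hXi hDi).trans ?_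
      filter_upwards [hD0] with ω hω
      rw [Pi.mul_apply, hω]; simp
    have htower := condExp_condExp_of_le (μ := Pr) (f := (fun ω => f (t (k + 1) ω)) *
        fun ω => R (k + 1) ω h - ρ (t (k + 1) ω)) (le_sup_left : ℱ k ≤ m') hle
    refine htower.symm.trans ((condExp_congr_ae hX0).trans ?_)
    simp

end Play

/-! ### The good event -/

section GoodEvent

variable {S A B : Type*} [DecidableEq S] [DecidableEq A] {H : ℕ}

lemma count₂_eq (t : ℕ → Traj S A B H) (k : ℕ) (h : Fin H) (s : S) (a : A) :
    count₂ t k h s a =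
      ((Finset.Icc 1 k).filter (fun τ => ((t τ).st h, (t τ).act₁ h) = (s, a))).card := by
  simp [count₂]

lemma sum_abs_pHat_sub_le [Fintype S] [Nonempty S] {t : ℕ → Traj S A B H} {n : ℕ} (hn : 1 ≤ n) {h : Fin H}
    {s : S} {a : A} {p : S → ℝ} {L : ℝ} (hL : 1 ≤ 4 * L) (hp : p ∈ stdSimplex ℝ S)
    (hW : ∀ W : Finset S, ∑ τ ∈ Finset.Icc 1 n,
      (if (t τ).st h = s ∧ (t τ).act₁ h = a then
        (signVec W ((t τ).next h) - ∑ s', p s' * signVec W s') / 2 else 0) ≤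
      √(2 * (((Fintype.card S : ℝ) + 3) * L) * (count₂ t n h s a : ℕ))) :
    ∑ s', |pHat t n h s a s' - p s'| ≤
      √(32 * (Fintype.card S : ℝ) * L) * (1 / √(max (count₂ t n h s a : ℝ) 1)) := by
  set N := count₂ t n h s a with hN
  have hS : (1 : ℝ) ≤ Fintype.card S := by exact_mod_cast Fintype.card_pos
  have hL0 : 0 ≤ L := by linarith
  have hpH : ∀ s', pHat t n h s a s' = (((Finset.Icc 1 n).filter
      (fun τ => (t τ).st h = s ∧ (t τ).act₁ h = a ∧ (t τ).next h = s')).card : ℝ) /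
      max (N : ℝ) 1 := fun s' => by rw [pHat, if_neg (by omega)]
  rcases Nat.eq_zero_or_pos N with h0 | hpos
  · have hz : ∀ s', pHat t n h s a s' = 0 := by
      intro s'
      have hle : ((Finset.Icc 1 n).filter
          (fun τ => (t τ).st h = s ∧ (t τ).act₁ h = a ∧ (t τ).next h = s')).card ≤ N :=
        Finset.card_le_card (Finset.monotone_filter_right _ fun τ _ hτ => ⟨hτ.1, hτ.2.1⟩)
      rw [hpH, Nat.le_zero.1 (hle.trans h0.le)]
      simp
    simp only [hz, zero_sub, abs_neg, abs_of_nonneg (hp.1 _), hp.2, h0, Nat.cast_zero,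
      max_eq_right zero_le_one, Real.sqrt_one, div_one, mul_one]
    exact Real.one_le_sqrt.2 (by nlinarith)
  · have h1 : (1 : ℝ) ≤ N := by exact_mod_cast hpos
    have h2 : (0 : ℝ) < N := by linarith
    rw [max_eq_left h1] at hpH ⊢
    -- The `ℓ¹` distance is attained at the sign vector of the overestimated states.
    set W : Finset S := Finset.univ.filter (fun s' => p s' < pHat t n h s a s') with hWdef
    have habs : ∀ s', |pHat t n h s a s' - p s'| = signVec W s' * (pHat t n h s a s' - p s') := by
      intro s'
      simp only [signVec, hWdef, Finset.mem_filter, Finset.mem_univ, true_and]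
      split_ifs with hlt
      · rw [abs_of_pos (sub_pos.2 hlt), one_mul]
      · rw [abs_of_nonpos (sub_nonpos.2 (not_lt.1 hlt)), neg_one_mul]
    have hemp : ∑ s', signVec W s' * pHat t n h s a s' = (∑ τ ∈ Finset.Icc 1 n,
        if (t τ).st h = s ∧ (t τ).act₁ h = a then signVec W ((t τ).next h) else 0) / N := by
      simp only [hpH, Finset.card_filter, Nat.cast_sum, mul_div_assoc', ← Finset.sum_div,
        Finset.mul_sum]
      rw [Finset.sum_comm]
      congr 1
      refine Finset.sum_congr rfl fun τ _ => ?_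
      split_ifs with hev
      · simp [hev.1, hev.2]
      · refine Finset.sum_eq_zero fun s' _ => ?_
        rw [if_neg (fun hh => hev ⟨hh.1, hh.2.1⟩)]; simp
    have hT : ∑ s', |pHat t n h s a s' - p s'| = 2 / N * ∑ τ ∈ Finset.Icc 1 n,
        (if (t τ).st h = s ∧ (t τ).act₁ h = a then
          (signVec W ((t τ).next h) - ∑ s', p s' * signVec W s') / 2 else 0) := by
      have h3 : ∑ τ ∈ Finset.Icc 1 n, (if (t τ).st h = s ∧ (t τ).act₁ h = a then
          (signVec W ((t τ).next h) - ∑ s', p s' * signVec W s') / 2 else 0) =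
          ((∑ τ ∈ Finset.Icc 1 n,
            if (t τ).st h = s ∧ (t τ).act₁ h = a then signVec W ((t τ).next h) else 0) -
          N * ∑ s', p s' * signVec W s') / 2 := by
        rw [hN, count₂, Finset.card_filter, Nat.cast_sum, Finset.sum_mul,
          ← Finset.sum_sub_distrib, Finset.sum_div]
        refine Finset.sum_congr rfl fun τ _ => ?_
        split_ifs <;> push_cast <;> ring
      rw [h3]
      simp only [habs, mul_sub, Finset.sum_sub_distrib, hemp]
      rw [Finset.sum_congr rfl fun s' _ => mul_comm (signVec W s') (p s')]
      field_simp
    rw [hT]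
    refine (mul_le_mul_of_nonneg_left (hW W) (by positivity)).trans ?_
    have h4 : (2 : ℝ) / N * √(2 * (((Fintype.card S : ℝ) + 3) * L) * N) =
        √(8 * ((Fintype.card S : ℝ) + 3) * L / N) := by
      have h5 : (8 * ((Fintype.card S : ℝ) + 3) * L / N : ℝ) =
          (2 / N) ^ 2 * (2 * (((Fintype.card S : ℝ) + 3) * L) * N) := by field_simp; ring
      rw [h5, Real.sqrt_mul (sq_nonneg (2 / (N : ℝ))), Real.sqrt_sq (by positivity)]
    rw [h4, mul_one_div, ← Real.sqrt_div (by positivity)]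
    refine Real.sqrt_le_sqrt (div_le_div_of_nonneg_right ?_ h2.le)
    nlinarith

variable [DecidableEq B]

lemma count₃_eq (t : ℕ → Traj S A B H) (k : ℕ) (h : Fin H) (s : S) (a : A) (b : B) :
    count₃ t k h s a b = ((Finset.Icc 1 k).filter
      (fun τ => ((t τ).st h, (t τ).act₁ h, (t τ).act₂ h) = (s, a, b))).card := by
  simp [count₃]

lemma abs_rHat_sub_le {t : ℕ → Traj S A B H} {R : ℕ → Fin H → ℝ} {n : ℕ} {h : Fin H} {s : S}
    {a : A} {b : B} {r L : ℝ} (hL : 1 ≤ 4 * L) (hr : r ∈ Set.Icc (0 : ℝ) 1)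
    (hup : ∑ τ ∈ Finset.Icc 1 n, (if (t τ).st h = s ∧ (t τ).act₁ h = a ∧ (t τ).act₂ h = b then
      1 * (R τ h - r) else 0) ≤ √(2 * (2 * L) * (count₃ t n h s a b : ℕ)))
    (hlo : ∑ τ ∈ Finset.Icc 1 n, (if (t τ).st h = s ∧ (t τ).act₁ h = a ∧ (t τ).act₂ h = b then
      (-1) * (R τ h - r) else 0) ≤ √(2 * (2 * L) * (count₃ t n h s a b : ℕ))) :
    |rHat t R n h s a b - r| ≤ √(4 * L / max (count₃ t n h s a b : ℝ) 1) := by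
  set N := count₃ t n h s a b with hN
  set T := ∑ τ ∈ Finset.Icc 1 n, (if (t τ).st h = s ∧ (t τ).act₁ h = a ∧ (t τ).act₂ h = b then
      1 * (R τ h - r) else 0) with hT
  have hneg : ∑ τ ∈ Finset.Icc 1 n, (if (t τ).st h = s ∧ (t τ).act₁ h = a ∧ (t τ).act₂ h = b then
      (-1) * (R τ h - r) else 0) = -T := by
    rw [hT, ← Finset.sum_neg_distrib]
    exact Finset.sum_congr rfl fun τ _ => by split_ifs <;> ring
  rw [hneg] at hlo
  have habs : |T| ≤ √(4 * L * N) := by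
    rw [show 4 * L = 2 * (2 * L) by ring, abs_le]
    constructor <;> linarith
  have hsum : ∑ τ ∈ Finset.Icc 1 n, (if (t τ).st h = s ∧ (t τ).act₁ h = a ∧ (t τ).act₂ h = b then
      R τ h else 0) = T + N * r := by
    rw [hT, hN, count₃, Finset.card_filter, Nat.cast_sum, Finset.sum_mul, ← Finset.sum_add_distrib]
    refine Finset.sum_congr rfl fun τ _ => ?_
    split_ifs <;> push_cast <;> ring
  rw [rHat, hsum, ← hN]
  rcases Nat.eq_zero_or_pos N with h0 | hpos
  · rw [h0] at habs ⊢
    have hT0 : T = 0 := by simpa using habs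
    simp only [hT0, Nat.cast_zero, zero_mul, add_zero, zero_sub, abs_neg,
      max_eq_right zero_le_one, div_one]
    rw [abs_of_nonneg hr.1]
    exact hr.2.trans (Real.one_le_sqrt.2 hL)
  · have h1 : (1 : ℝ) ≤ N := by exact_mod_cast hpos
    have h2 : (0 : ℝ) < N := by linarith
    rw [max_eq_left h1]
    have h3 : (T + N * r) / N - r = T / N := by field_simp; ring
    rw [h3, abs_div, abs_of_pos h2, div_le_iff₀ h2]
    refine habs.trans (le_of_eq ?_)
    have h4 : (4 * L * N : ℝ) = 4 * L / N * N ^ 2 := by field_simp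
    rw [h4, Real.sqrt_mul (by positivity), Real.sqrt_sq h2.le]

variable [Fintype S] [Fintype A] [Fintype B]

/-- The estimates on which the regret bound rests: the empirical rewards and transitions are
accurate at the scale `L`, and the visit counts grow as fast as expected under the played
policies. -/
structure GoodRun (G : Game S A B H) (K : ℕ) (L : ℝ) (t : ℕ → Traj S A B H) (R : ℕ → Fin H → ℝ)
    (μ : ℕ → Policy S A H) (ν : ℕ → Policy S B H) : Prop where
  reward : ∀ n, 1 ≤ n → n ≤ K → ∀ h s a b,
    |rHat t R n h s a b - G.r h s a b| ≤ √(4 * L / max (count₃ t n h s a b : ℝ) 1)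
  transition : ∀ n, 1 ≤ n → n ≤ K → ∀ h s a,
    ∑ s', |pHat t n h s a s' - G.P h s a s'| ≤
      √(32 * (Fintype.card S : ℝ) * L) * (1 / √(max (count₂ t n h s a : ℝ) 1))
  visits₂ : ∀ h, ∑ k ∈ Finset.range K, ∑ s, ∑ a,
    reach G.s₁ (μ (k + 1)) G.P h.castSucc s * μ (k + 1) h s a *
      (1 / √(max (count₂ t k h s a : ℝ) 1)) ≤
    3 * √((Fintype.card S : ℝ) * Fintype.card A * K) + √(6 * L * K)
  visits₃ : ∀ h, ∑ k ∈ Finset.range K, ∑ s, ∑ a, ∑ b,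
    reach G.s₁ (μ (k + 1)) G.P h.castSucc s * μ (k + 1) h s a * ν (k + 1) h s b *
      (1 / √(max (count₃ t k h s a b : ℝ) 1)) ≤
    3 * √((Fintype.card S : ℝ) * Fintype.card A * Fintype.card B * K) + √(6 * L * K)

/-- A finite union bound with the same bound for every set. -/
lemma measureReal_iUnion_le_card_mul {Ω ι : Type*} {mΩ : MeasurableSpace Ω} [Fintype ι]
    {Pr : Measure Ω} [IsProbabilityMeasure Pr] (f : ι → Set Ω) {c : ℝ}
    (hf : ∀ i, Pr.real (f i) ≤ c) : Pr.real (⋃ i, f i) ≤ Fintype.card ι * c := by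
  refine (measureReal_iUnion_fintype_le f).trans ((Finset.sum_le_sum fun i _ => hf i).trans ?_)
  simp

/-- With probability at least `1 - 2 δ` the run is good. -/
theorem IsPlay.exists_goodRun [Nonempty A] [Nonempty B] {Ω : Type*} {mΩ : MeasurableSpace Ω}
    {G : Game S A B H} {K : ℕ} (hH : 1 ≤ H) (hK : 1 ≤ K) {Pr : Measure Ω} [IsProbabilityMeasure Pr]
    {ℱ : Filtration ℕ mΩ} {μ : ℕ → Ω → Policy S A H} {ν : ℕ → Ω → Policy S B H}
    {t : ℕ → Ω → Traj S A B H} {R : ℕ → Ω → Fin H → ℝ} (hp : IsPlay G K Pr ℱ μ ν t R)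
    (hν : ∀ k < K, ∀ ω, IsPolicy (ν (k + 1) ω)) {δ : ℝ} (hδ : 0 < δ) (hδ2 : δ ≤ 1 / 2) {L : ℝ}
    (hL : L = Real.log ((Fintype.card S : ℝ) * Fintype.card A * Fintype.card B * H * K / δ)) :
    ∃ bad : Set Ω, Pr.real bad ≤ 2 * δ ∧ ∀ ω ∉ bad,
      GoodRun G K L (fun k => t k ω) (fun k => R k ω) (fun k => μ k ω) (fun k => ν k ω) := by
  have _ : Nonempty S := ⟨G.s₁⟩
  have hS1 : (1 : ℝ) ≤ Fintype.card S := by exact_mod_cast Fintype.card_pos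
  have hA1 : (1 : ℝ) ≤ Fintype.card A := by exact_mod_cast Fintype.card_pos
  have hB1 : (1 : ℝ) ≤ Fintype.card B := by exact_mod_cast Fintype.card_pos
  have hH1 : (1 : ℝ) ≤ H := by exact_mod_cast hH
  have hK1 : (1 : ℝ) ≤ K := by exact_mod_cast hK
  set N : ℝ := (Fintype.card S : ℝ) * Fintype.card A * Fintype.card B * H * K with hN
  have hSAH : (1 : ℝ) ≤ Fintype.card S * Fintype.card A * H :=
    one_le_mul_of_one_le_of_one_le (one_le_mul_of_one_le_of_one_le hS1 hA1) hH1
  have hNeq : N = Fintype.card S * Fintype.card A * H * Fintype.card B * K := by rw [hN]; ring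
  have hSAHB : (1 : ℝ) ≤ Fintype.card S * Fintype.card A * H * Fintype.card B :=
    one_le_mul_of_one_le_of_one_le hSAH hB1
  have hKN : (K : ℝ) ≤ N := by
    rw [hNeq]; exact le_mul_of_one_le_left (by linarith) hSAHB
  have hN1 : 1 ≤ N := hK1.trans hKN
  have hN0 : 0 < N := by linarith
  have hHK : (H : ℝ) * K ≤ N := by
    have h1 : (1 : ℝ) ≤ Fintype.card S * Fintype.card A * Fintype.card B :=
      one_le_mul_of_one_le_of_one_le (one_le_mul_of_one_le_of_one_le hS1 hA1) hB1
    rw [hN, mul_assoc]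
    exact le_mul_of_one_le_left (by positivity) h1
  have hx : Real.exp (-L) = δ / N := by
    rw [hL, Real.exp_neg, Real.exp_log (by positivity), inv_div]
  set x := Real.exp (-L) with hxdef
  have hx0 : 0 < x := Real.exp_pos _
  have hNx : N * x = δ := by rw [hx]; field_simp
  have hxδ : x ≤ δ := by rw [← hNx]; exact le_mul_of_one_le_left hx0.le hN1
  have hL2 : Real.log 2 ≤ L := by
    rw [hL]
    refine Real.log_le_log (by norm_num) ?_
    rw [le_div_iff₀ hδ]; linarith
  have hL4 : 1 ≤ 4 * L := by have := Real.log_two_gt_d9; linarith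
  have hL0 : 0 ≤ L := by linarith
  let B₁ : Fin H × S × A × B × Fin K × Bool → Set Ω := fun i => {ω |
    √(2 * (2 * L) * (count₃ (fun k => t k ω) (i.2.2.2.2.1 + 1) i.1 i.2.1 i.2.2.1 i.2.2.2.1 : ℕ)) <
      ∑ τ ∈ Finset.Icc 1 (i.2.2.2.2.1 + 1 : ℕ),
        if (t τ ω).st i.1 = i.2.1 ∧ (t τ ω).act₁ i.1 = i.2.2.1 ∧ (t τ ω).act₂ i.1 = i.2.2.2.1 then
          (if i.2.2.2.2.2 then 1 else -1) * (R τ ω i.1 - G.r i.1 i.2.1 i.2.2.1 i.2.2.2.1) else 0}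
  let B₂ : Fin H × S × A × Fin K × Finset S → Set Ω := fun i => {ω |
    √(2 * (((Fintype.card S : ℝ) + 3) * L) *
      (count₂ (fun k => t k ω) (i.2.2.2.1 + 1) i.1 i.2.1 i.2.2.1 : ℕ)) <
      ∑ τ ∈ Finset.Icc 1 (i.2.2.2.1 + 1 : ℕ),
        if (t τ ω).st i.1 = i.2.1 ∧ (t τ ω).act₁ i.1 = i.2.2.1 then
        (signVec i.2.2.2.2 ((t τ ω).next i.1) -
          ∑ s', G.P i.1 i.2.1 i.2.2.1 s' * signVec i.2.2.2.2 s') / 2 else 0}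
  let B₃ : Fin H → Set Ω := fun h => {ω |
    3 * √((Fintype.card (S × A) : ℝ) * K) + √(2 * (3 * L) * K) <
      ∑ k ∈ Finset.range K, ∑ x, trajProb G (μ (k + 1) ω) (ν (k + 1) ω) x *
        (1 / √(max ((((Finset.Icc 1 k).filter (fun τ => ((t τ ω).st h, (t τ ω).act₁ h) =
          (x.st h, x.act₁ h))).card : ℕ) : ℝ) 1))}
  let B₄ : Fin H → Set Ω := fun h => {ω |
    3 * √((Fintype.card (S × A × B) : ℝ) * K) + √(2 * (3 * L) * K) <
      ∑ k ∈ Finset.range K, ∑ x, trajProb G (μ (k + 1) ω) (ν (k + 1) ω) x *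
        (1 / √(max ((((Finset.Icc 1 k).filter (fun τ => ((t τ ω).st h, (t τ ω).act₁ h,
          (t τ ω).act₂ h) = (x.st h, x.act₁ h, x.act₂ h))).card : ℕ) : ℝ) 1))}
  have hpow2 : Real.exp (-(2 * L)) = x ^ 2 := by
    rw [hxdef, ← Real.exp_nat_mul]; congr 1; push_cast; ring
  have hpow3 : Real.exp (-(3 * L)) = x ^ 3 := by
    rw [hxdef, ← Real.exp_nat_mul]; congr 1; push_cast; ring
  have hb1 : Pr.real (⋃ i, B₁ i) ≤ δ := by
    refine (measureReal_iUnion_le_card_mul B₁ (c := K * Real.exp (-(2 * L))) fun i => ?_).trans ?_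
    · exact hp.measureReal_reward_le i.1 i.2.1 i.2.2.1 i.2.2.2.1 (by split_ifs <;> simp)
        (by linarith) i.2.2.2.2.1.isLt
    · simp only [Fintype.card_prod, Fintype.card_fin, Fintype.card_bool, Nat.cast_mul,
        Nat.cast_ofNat]
      rw [hpow2]
      calc _ = 2 * (N * x) * (K * x) := by rw [hN]; ring
        _ ≤ 2 * (N * x) * (N * x) :=
            mul_le_mul_of_nonneg_left (mul_le_mul_of_nonneg_right hKN hx0.le) (by positivity)
        _ ≤ δ := by rw [hNx]; nlinarith
  have hb2 : Pr.real (⋃ i, B₂ i) ≤ δ / 2 := by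
    refine (measureReal_iUnion_le_card_mul B₂
      (c := K * Real.exp (-(((Fintype.card S : ℝ) + 3) * L))) fun i => ?_).trans ?_
    · exact hp.measureReal_transition_le hν i.1 i.2.1 i.2.2.1 i.2.2.2.2
        (by positivity) i.2.2.2.1.isLt
    · simp only [Fintype.card_prod, Fintype.card_fin, Fintype.card_finset, Nat.cast_mul,
        Nat.cast_pow, Nat.cast_ofNat]
      have hexp : Real.exp (-(((Fintype.card S : ℝ) + 3) * L)) = x ^ Fintype.card S * x ^ 3 := by
        rw [← hpow3, hxdef, ← Real.exp_nat_mul, ← Real.exp_add]; congr 1; ring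
      have h2x : (2 : ℝ) ^ Fintype.card S * x ^ Fintype.card S ≤ 1 := by
        rw [← mul_pow]
        exact pow_le_one₀ (by positivity) (by linarith)
      have hB : (Fintype.card S * Fintype.card A * H * K : ℝ) ≤ N := by
        rw [hNeq, mul_right_comm _ (Fintype.card B : ℝ)]
        exact le_mul_of_one_le_right (by positivity) hB1
      rw [hexp]
      calc _ = (2 ^ Fintype.card S * x ^ Fintype.card S) *
              ((Fintype.card S * Fintype.card A * H * K * x) * (K * x) * x) := by ring
        _ ≤ 1 * ((N * x) * (N * x) * x) := by
            refine mul_le_mul h2x ?_ (by positivity) zero_le_one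
            gcongr
        _ ≤ δ / 2 := by
            rw [hNx, one_mul]
            nlinarith [mul_pos hδ hδ, mul_le_mul_of_nonneg_left hxδ (mul_pos hδ hδ).le]
  have hHKx : (H : ℝ) * (K * Real.exp (-(3 * L))) ≤ δ / 4 := by
    rw [hpow3]
    calc (H : ℝ) * (K * x ^ 3) = (H * K * x) * x ^ 2 := by ring
      _ ≤ (N * x) * (1 / 2) ^ 2 := by
          refine mul_le_mul (mul_le_mul_of_nonneg_right hHK hx0.le)
            (pow_le_pow_left₀ hx0.le (by linarith) 2) (by positivity) (by positivity)
      _ = δ / 4 := by rw [hNx]; ring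
  have hb3 : Pr.real (⋃ i, B₃ i) ≤ δ / 4 := by
    refine (measureReal_iUnion_le_card_mul B₃ (c := K * Real.exp (-(3 * L))) fun h => ?_).trans
      (by simpa using hHKx)
    exact hp.measureReal_visits_le hν (fun x => (x.st h, x.act₁ h)) (by linarith)
  have hb4 : Pr.real (⋃ i, B₄ i) ≤ δ / 4 := by
    refine (measureReal_iUnion_le_card_mul B₄ (c := K * Real.exp (-(3 * L))) fun h => ?_).trans
      (by simpa using hHKx)
    exact hp.measureReal_visits_le hν (fun x => (x.st h, x.act₁ h, x.act₂ h)) (by linarith)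
  refine ⟨((⋃ i, B₁ i) ∪ ⋃ i, B₂ i) ∪ ((⋃ i, B₃ i) ∪ ⋃ i, B₄ i), ?_, fun ω hω => ?_⟩
  · have h1 := measureReal_union_le (μ := Pr) ((⋃ i, B₁ i) ∪ ⋃ i, B₂ i)
      ((⋃ i, B₃ i) ∪ ⋃ i, B₄ i)
    have h2 := measureReal_union_le (μ := Pr) (⋃ i, B₁ i) (⋃ i, B₂ i)
    have h3 := measureReal_union_le (μ := Pr) (⋃ i, B₃ i) (⋃ i, B₄ i)
    linarith
  · simp only [Set.mem_union, Set.mem_iUnion, not_or, not_exists] at hω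
    obtain ⟨⟨hω1, hω2⟩, hω3, hω4⟩ := hω
    refine ⟨fun n hn hnK h s a b => ?_, fun n hn hnK h s a => ?_, fun h => ?_, fun h => ?_⟩
    · obtain ⟨n, rfl⟩ : ∃ m, n = m + 1 := ⟨n - 1, by omega⟩
      refine abs_rHat_sub_le hL4 (G.r_mem h s a b) ?_ ?_
      · exact not_lt.1 (hω1 (h, s, a, b, ⟨n, by omega⟩, true))
      · exact not_lt.1 (hω1 (h, s, a, b, ⟨n, by omega⟩, false))
    · obtain ⟨n, rfl⟩ : ∃ m, n = m + 1 := ⟨n - 1, by omega⟩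
      exact sum_abs_pHat_sub_le hn hL4 (G.P_mem h s a) fun W =>
        not_lt.1 (hω2 (h, s, a, ⟨n, by omega⟩, W))
    · have h1 := hω3 h
      simp only [B₃, Set.mem_ofPred_eq, not_lt] at h1
      rw [Fintype.card_prod, Nat.cast_mul, ← mul_assoc, show (2 : ℝ) * 3 = 6 by norm_num] at h1
      refine le_trans (le_of_eq (Finset.sum_congr rfl fun k hk => ?_)) h1
      have hk' := Finset.mem_range.1 hk
      have h2 := sum_trajProb_mul_next G (hp.policy₁ k hk' ω) (hν k hk' ω) h (fun s a _ =>
        1 / √(max (count₂ (fun k => t k ω) k h s a : ℝ) 1))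
      simp only [← Finset.sum_mul, (G.P_mem h _ _).2, one_mul] at h2
      rw [← h2]
      simp only [count₂_eq]
    · have h1 := hω4 h
      simp only [B₄, Set.mem_ofPred_eq, not_lt] at h1
      rw [Fintype.card_prod, Fintype.card_prod, Nat.cast_mul, Nat.cast_mul, ← mul_assoc, ← mul_assoc,
        show (2 : ℝ) * 3 = 6 by norm_num] at h1
      refine le_trans (le_of_eq (Finset.sum_congr rfl fun k hk => ?_)) h1
      have hk' := Finset.mem_range.1 hk
      have h2 := sum_trajProb_mul_act G (hp.policy₁ k hk' ω) (hν k hk' ω) h (fun s a b =>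
        1 / √(max (count₃ (fun k => t k ω) k h s a b : ℝ) 1))
      rw [← h2]
      simp only [count₃_eq]

end GoodEvent

/-! ### The regret bound on the good event -/

section Regret

lemma pHat_nonneg {S A B : Type*} [Fintype S] [DecidableEq S] [DecidableEq A] {H : ℕ}
    (t : ℕ → Traj S A B H) (k : ℕ) (h : Fin H) (s : S) (a : A) (s' : S) :
    0 ≤ pHat t k h s a s' := by
  unfold pHat; split_ifs <;> positivity

lemma sum_pHat_le_one {S A B : Type*} [Fintype S] [DecidableEq S] [DecidableEq A] {H : ℕ}
    (t : ℕ → Traj S A B H) (k : ℕ) (h : Fin H) (s : S) (a : A) :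
    ∑ s', pHat t k h s a s' ≤ 1 := by
  have _ : Nonempty S := ⟨s⟩
  have hS : (0 : ℝ) < Fintype.card S := by exact_mod_cast Fintype.card_pos
  unfold pHat
  split_ifs
  · simp only [Finset.sum_const, Finset.card_univ, nsmul_eq_mul]
    exact (mul_one_div_cancel hS.ne').le
  · have h1 : ∑ s', ((Finset.Icc 1 k).filter
        (fun τ => (t τ).st h = s ∧ (t τ).act₁ h = a ∧ (t τ).next h = s')).card =
        count₂ t k h s a := by
      rw [count₂, Finset.card_eq_sum_card_fiberwise (f := fun τ => (t τ).next h)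
        (t := Finset.univ) (fun _ _ => Finset.mem_coe.2 (Finset.mem_univ _))]
      simp only [Finset.filter_filter, and_assoc]
    rw [← Finset.sum_div, ← Nat.cast_sum, h1]
    exact div_le_one_of_le₀ (le_max_left _ _) (le_trans zero_le_one (le_max_right _ _))

/-- The instantaneous regret at one `(h, s)`, for a true weight `q` and an estimated weight `d` of
the state, and for a pessimistic estimate `r'` of the reward `r`. -/
lemma loss_sub_le {A B : Type*} [Fintype A] [Fintype B] {q d : ℝ} (hq : 0 ≤ q) {μ : A → ℝ}
    (hμ : μ ∈ stdSimplex ℝ A) {ν ν' : B → ℝ} (hν : ν ∈ stdSimplex ℝ B) (hν' : ν' ∈ stdSimplex ℝ B)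
    {r r' β : A → B → ℝ} (h0 : ∀ a b, 0 ≤ r' a b) (hr : ∀ a b, r' a b ≤ r a b)
    (hr1 : ∀ a b, r a b ≤ 1) (hβ : ∀ a b, r a b - r' a b ≤ β a b) :
    ∑ a, ∑ b, q * μ a * ν b * r a b - ∑ a, ∑ b, q * μ a * ν' b * r a b ≤
      ∑ a, ∑ b, q * μ a * ν b * β a b + |q - d| +
        ∑ b, (d * ∑ a, μ a * r' a b) * (ν b - ν' b) := by
  set g : B → ℝ := fun b => ∑ a, μ a * r' a b with hg
  have hg0 : ∀ b, 0 ≤ g b := fun b => Finset.sum_nonneg fun a _ => mul_nonneg (hμ.1 a) (h0 a b)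
  have hg1 : ∀ b, g b ≤ 1 := fun b => by
    rw [← hμ.2]
    exact Finset.sum_le_sum fun a _ =>
      mul_le_of_le_one_right (hμ.1 a) ((hr a b).trans (hr1 a b))
  have hmean : ∀ π ∈ stdSimplex ℝ B, 0 ≤ ∑ b, g b * π b ∧ ∑ b, g b * π b ≤ 1 := fun π hπ => by
    refine ⟨Finset.sum_nonneg fun b _ => mul_nonneg (hg0 b) (hπ.1 b), ?_⟩
    rw [← hπ.2]
    exact Finset.sum_le_sum fun b _ => mul_le_of_le_one_left (hπ.1 b) (hg1 b)
  have hsplit : ∑ a, ∑ b, q * μ a * ν b * r a b - ∑ a, ∑ b, q * μ a * ν' b * r a b =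
      ∑ a, ∑ b, q * μ a * ν b * (r a b - r' a b) - ∑ a, ∑ b, q * μ a * ν' b * (r a b - r' a b) +
        q * (∑ b, g b * ν b - ∑ b, g b * ν' b) := by
    have h1 : ∀ π : B → ℝ, q * ∑ b, g b * π b = ∑ a, ∑ b, q * μ a * π b * r' a b := by
      intro π
      rw [Finset.sum_comm, Finset.mul_sum]
      refine Finset.sum_congr rfl fun b _ => ?_
      rw [hg, Finset.sum_mul, Finset.mul_sum]
      exact Finset.sum_congr rfl fun a _ => by ring
    rw [mul_sub, h1, h1]
    simp only [mul_sub, Finset.sum_sub_distrib]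
    ring
  have hw : ∀ π ∈ stdSimplex ℝ B, ∀ a b, 0 ≤ q * μ a * π b := fun π hπ a b =>
    mul_nonneg (mul_nonneg hq (hμ.1 a)) (hπ.1 b)
  have h1 : ∑ a, ∑ b, q * μ a * ν b * (r a b - r' a b) ≤ ∑ a, ∑ b, q * μ a * ν b * β a b :=
    Finset.sum_le_sum fun a _ => Finset.sum_le_sum fun b _ =>
      mul_le_mul_of_nonneg_left (hβ a b) (hw ν hν a b)
  have h2 : 0 ≤ ∑ a, ∑ b, q * μ a * ν' b * (r a b - r' a b) :=
    Finset.sum_nonneg fun a _ => Finset.sum_nonneg fun b _ =>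
      mul_nonneg (hw ν' hν' a b) (sub_nonneg.2 (hr a b))
  have h3 : (q - d) * (∑ b, g b * ν b - ∑ b, g b * ν' b) ≤ |q - d| := by
    refine (le_abs_self _).trans ?_
    rw [abs_mul]
    refine mul_le_of_le_one_right (abs_nonneg _) (abs_le.2 ⟨?_, ?_⟩) <;>
      linarith [(hmean ν hν).1, (hmean ν hν).2, (hmean ν' hν').1, (hmean ν' hν').2]
  have h4 : ∑ b, (d * g b) * (ν b - ν' b) = d * (∑ b, g b * ν b - ∑ b, g b * ν' b) := by
    rw [← Finset.sum_sub_distrib, Finset.mul_sum]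
    exact Finset.sum_congr rfl fun b _ => by ring
  rw [hsplit, h4]
  linarith

variable {S A B : Type*} [Fintype S] [DecidableEq S] [Fintype A] [DecidableEq A]
  [Fintype B] [DecidableEq B] {H : ℕ} {G : Game S A B H} {K : ℕ} {L δ : ℝ}
  {t : ℕ → Traj S A B H} {R : ℕ → Fin H → ℝ} {μ : ℕ → Policy S A H} {ν : ℕ → Policy S B H}

/-- The regret of the mirror descent iterates against the losses that the algorithm builds. -/
lemma RunsAlgorithm.sum_mdLoss_le [Nonempty B] {s₁ : S} (hK : 1 ≤ K)
    (hrun : RunsAlgorithm s₁ K δ t R μ ν) (hμ : ∀ k < K, IsPolicy (μ (k + 1)))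
    (hr1 : ∀ k < K, ∀ h s a b, rTilde K δ t R (k + 1) h s a b ≤ 1)
    {π : Policy S B H} (hπ : IsPolicy π) :
    ∑ k ∈ Finset.range K, ∑ h, ∑ s, ∑ b,
      mdLoss s₁ K δ t R (k + 1) (μ (k + 1)) h s b * (ν (k + 1) h s b - π h s b) ≤
      3 / 2 * (H * √((Fintype.card S : ℝ) * Real.log (Fintype.card B) * K)) := by
  have _ : Nonempty S := ⟨s₁⟩
  rcases Nat.lt_or_ge (Fintype.card B) 2 with hB | hB
  · -- With a single action there is a single policy.
    have hsub : Subsingleton B := Fintype.card_le_one_iff_subsingleton.1 (by omega)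
    have hone : ∀ p ∈ stdSimplex ℝ B, ∀ b, p b = 1 := by
      intro p hp b
      rw [← hp.2]
      exact (Fintype.sum_subsingleton p b).symm
    refine le_trans (le_of_eq (Finset.sum_eq_zero fun k hk => Finset.sum_eq_zero fun h _ =>
      Finset.sum_eq_zero fun s _ => Finset.sum_eq_zero fun b _ => ?_)) (by positivity)
    rw [hone _ ((hrun.2 k (Finset.mem_range.1 hk)).1 h s) b, hone _ (hπ h s) b, sub_self, mul_zero]
  set γ := stepSize S B K with hγdef
  have hγ : 0 < γ := stepSize_pos hK hB
  set d : ℕ → Fin H → S → ℝ := fun k h s => reach s₁ (μ k) (pHat t k) h.castSucc s with hd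
  have hd0 : ∀ k < K, ∀ h s, 0 ≤ d (k + 1) h s := fun k hk h s =>
    reach_nonneg s₁ (hμ k hk) (pHat_nonneg t _) _ _
  have hd1 : ∀ k < K, ∀ h, ∑ s, d (k + 1) h s ≤ 1 := fun k hk h =>
    sum_reach_le_one s₁ (hμ k hk) (pHat_nonneg t _) (sum_pHat_le_one t _) _
  have hr0 : ∀ k h s a b, 0 ≤ rTilde K δ t R k h s a b := fun k h s a b => le_max_right _ _
  have hbound : ∀ h s, ∑ k ∈ Finset.range K, ∑ b,
      mdLoss s₁ K δ t R (k + 1) (μ (k + 1)) h s b * (ν (k + 1) h s b - π h s b) ≤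
      Real.log (Fintype.card B) / γ + γ / 2 * ∑ k ∈ Finset.range K, d (k + 1) h s ^ 2 := by
    intro h s
    have h1 := mw_regret_le hγ K (fun k => mdLoss s₁ K δ t R k (μ k) h s) (fun k => ν k h s)
      (fun k => if k = 0 then 0 else d k h s) (hrun.1 h s) (fun k hk => hrun.eq_mwUpdate hK hB hk h s)
      ?_ ?_ (hπ h s)
    · rw [Finset.sum_range_succ', Finset.sum_range_succ' _ K] at h1
      simpa [mdLoss_zero] using h1
    · rintro (_ | k) hk b
      · simp [mdLoss_zero]
      · exact mul_nonneg (hd0 k hk h s) (Finset.sum_nonneg fun a _ =>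
          mul_nonneg ((hμ k hk h s).1 a) (hr0 _ _ _ _ _))
    · rintro (_ | k) hk b
      · simp [mdLoss_zero]
      · refine mul_le_of_le_one_right (hd0 k hk h s) ?_
        rw [← (hμ k hk h s).2]
        exact Finset.sum_le_sum fun a _ =>
          mul_le_of_le_one_right ((hμ k hk h s).1 a) (hr1 k hk h s a b)
  have hsq : ∀ h, ∑ s, ∑ k ∈ Finset.range K, d (k + 1) h s ^ 2 ≤ K := by
    intro h
    rw [Finset.sum_comm]
    calc ∑ k ∈ Finset.range K, ∑ s, d (k + 1) h s ^ 2 ≤ ∑ k ∈ Finset.range K, 1 := by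
          refine Finset.sum_le_sum fun k hk => ?_
          have hk' := Finset.mem_range.1 hk
          refine le_trans (Finset.sum_le_sum fun s _ => ?_) (hd1 k hk' h)
          have h1 : d (k + 1) h s ≤ 1 := (Finset.single_le_sum (fun s _ => hd0 k hk' h s)
            (Finset.mem_univ s)).trans (hd1 k hk' h)
          nlinarith [hd0 k hk' h s]
      _ = K := by simp
  have hK0 : (0 : ℝ) < K := by exact_mod_cast hK
  set l := Real.log (Fintype.card B) with hl
  have hl0 : 0 ≤ l := Real.log_natCast_nonneg _
  set w := √((Fintype.card S : ℝ) * l * K) with hw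
  have hγK : γ * K = w := by
    rw [hγdef, stepSize, hw, ← hl]
    have : (Fintype.card S : ℝ) * l * K = (Fintype.card S : ℝ) * l / K * K ^ 2 := by field_simp
    rw [this, Real.sqrt_mul (by positivity), Real.sqrt_sq hK0.le]
  have hγS : (Fintype.card S : ℝ) * (l / γ) = w := by
    have h1 : γ ^ 2 * K = (Fintype.card S : ℝ) * l := by
      rw [hγdef, stepSize, Real.sq_sqrt (by positivity), ← hl]; field_simp
    rw [← hγK, mul_div_assoc', div_eq_iff hγ.ne', ← h1]; ring
  calc _ = ∑ h, ∑ s, ∑ k ∈ Finset.range K, ∑ b,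
      mdLoss s₁ K δ t R (k + 1) (μ (k + 1)) h s b * (ν (k + 1) h s b - π h s b) := by
        rw [Finset.sum_comm]
        exact Finset.sum_congr rfl fun h _ => Finset.sum_comm
    _ ≤ ∑ h : Fin H, 3 / 2 * w := by
        refine Finset.sum_le_sum fun h _ => (Finset.sum_le_sum fun s _ => hbound h s).trans ?_
        rw [Finset.sum_add_distrib, ← Finset.mul_sum, Finset.sum_const, Finset.card_univ,
          nsmul_eq_mul, hγS]
        have h1 := mul_le_mul_of_nonneg_left (hsq h) (by positivity : 0 ≤ γ / 2)
        linarith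
    _ = 3 / 2 * (H * w) := by simp; ring

lemma one_div_sqrt_max_anti {m n : ℕ} (h : m ≤ n) :
    1 / √(max (n : ℝ) 1) ≤ 1 / √(max (m : ℝ) 1) := by
  have h1 : (1 : ℝ) ≤ max (m : ℝ) 1 := le_max_right _ _
  refine one_div_le_one_div_of_le (Real.sqrt_pos.2 (by linarith)) (Real.sqrt_le_sqrt ?_)
  exact max_le_max (by exact_mod_cast h) le_rfl

lemma count₂_le_succ {S A B : Type*} [DecidableEq S] [DecidableEq A] {H : ℕ}
    (t : ℕ → Traj S A B H) (k : ℕ) (h : Fin H) (s : S) (a : A) :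
    count₂ t k h s a ≤ count₂ t (k + 1) h s a :=
  Finset.card_le_card (Finset.filter_subset_filter _ (Finset.Icc_subset_Icc_right (by omega)))

lemma count₃_le_succ {S A B : Type*} [DecidableEq S] [DecidableEq A] [DecidableEq B] {H : ℕ}
    (t : ℕ → Traj S A B H) (k : ℕ) (h : Fin H) (s : S) (a : A) (b : B) :
    count₃ t k h s a b ≤ count₃ t (k + 1) h s a b :=
  Finset.card_le_card (Finset.filter_subset_filter _ (Finset.Icc_subset_Icc_right (by omega)))

/-- On a good run, the state distributions under the empirical model are close to the true ones. -/
lemma GoodRun.sum_abs_reach_sub_le (hg : GoodRun G K L t R μ ν)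
    (hμ : ∀ k < K, IsPolicy (μ (k + 1))) :
    ∑ k ∈ Finset.range K, ∑ h : Fin H, ∑ s, |reach G.s₁ (μ (k + 1)) G.P h.castSucc s -
        reach G.s₁ (μ (k + 1)) (pHat t (k + 1)) h.castSucc s| ≤
      (H : ℝ) ^ 2 * (√(32 * (Fintype.card S : ℝ) * L) *
        (3 * √((Fintype.card S : ℝ) * Fintype.card A * K) + √(6 * L * K))) := by
  set w := √(32 * (Fintype.card S : ℝ) * L) with hw
  have hP0 : ∀ h s a s', 0 ≤ G.P h s a s' := fun h s a => (G.P_mem h s a).1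
  have h1 : ∀ k < K, ∀ h : Fin H, ∑ s, |reach G.s₁ (μ (k + 1)) G.P h.castSucc s -
        reach G.s₁ (μ (k + 1)) (pHat t (k + 1)) h.castSucc s| ≤
      ∑ j : Fin H, w * ∑ s, ∑ a, reach G.s₁ (μ (k + 1)) G.P j.castSucc s * μ (k + 1) j s a *
        (1 / √(max (count₂ t k j s a : ℝ) 1)) := by
    intro k hk h
    refine (MarkovGame.sum_abs_reach_sub_le G.s₁ (hμ k hk) hP0 (pHat_nonneg t _)
      (sum_pHat_le_one t _) _).trans (Finset.sum_le_sum fun j _ => ?_)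
    rw [Finset.mul_sum]
    refine Finset.sum_le_sum fun s _ => ?_
    rw [Finset.mul_sum]
    refine Finset.sum_le_sum fun a _ => ?_
    have h2 := hg.transition (k + 1) (by omega) hk j s a
    have h3 := mul_le_mul_of_nonneg_left (one_div_sqrt_max_anti (count₂_le_succ t k j s a))
      (Real.sqrt_nonneg (32 * (Fintype.card S : ℝ) * L))
    refine (mul_le_mul_of_nonneg_left (h2.trans h3) (mul_nonneg
      (reach_nonneg G.s₁ (hμ k hk) hP0 _ _) ((hμ k hk j s).1 a))).trans (le_of_eq ?_)
    rw [← hw]; ring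
  calc _ ≤ ∑ k ∈ Finset.range K, ∑ _h : Fin H, ∑ j : Fin H, w * ∑ s, ∑ a,
        reach G.s₁ (μ (k + 1)) G.P j.castSucc s * μ (k + 1) j s a *
          (1 / √(max (count₂ t k j s a : ℝ) 1)) :=
        Finset.sum_le_sum fun k hk => Finset.sum_le_sum fun h _ => h1 k (Finset.mem_range.1 hk) h
    _ = H * ∑ j : Fin H, w * ∑ k ∈ Finset.range K, ∑ s, ∑ a,
        reach G.s₁ (μ (k + 1)) G.P j.castSucc s * μ (k + 1) j s a *
          (1 / √(max (count₂ t k j s a : ℝ) 1)) := by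
        simp only [Finset.sum_const, Finset.card_univ, Fintype.card_fin, nsmul_eq_mul,
          ← Finset.mul_sum]
        rw [Finset.sum_comm]
    _ ≤ H * ∑ j : Fin H, w *
        (3 * √((Fintype.card S : ℝ) * Fintype.card A * K) + √(6 * L * K)) := by
        refine mul_le_mul_of_nonneg_left (Finset.sum_le_sum fun j _ => ?_) (Nat.cast_nonneg H)
        exact mul_le_mul_of_nonneg_left (hg.visits₂ j) (Real.sqrt_nonneg _)
    _ = _ := by simp; ring

lemma GoodRun.rTilde_le (hg : GoodRun G K L t R μ ν)
    (hL : L = Real.log ((Fintype.card S : ℝ) * Fintype.card A * Fintype.card B * H * K / δ))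
    {k : ℕ} (hk : k < K) (h : Fin H) (s : S) (a : A) (b : B) :
    rTilde K δ t R (k + 1) h s a b ≤ G.r h s a b := by
  have h1 := abs_le.1 (hg.reward (k + 1) (by omega) hk h s a b)
  refine max_le ?_ (G.r_mem h s a b).1
  rw [bonus, if_neg (by omega), ← hL]
  linarith

lemma GoodRun.sub_rTilde_le (hg : GoodRun G K L t R μ ν)
    (hL : L = Real.log ((Fintype.card S : ℝ) * Fintype.card A * Fintype.card B * H * K / δ))
    (hL0 : 0 ≤ L) {k : ℕ} (hk : k < K) (h : Fin H) (s : S) (a : A) (b : B) :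
    G.r h s a b - rTilde K δ t R (k + 1) h s a b ≤
      4 * √L * (1 / √(max (count₃ t k h s a b : ℝ) 1)) := by
  have h1 := abs_le.1 (hg.reward (k + 1) (by omega) hk h s a b)
  have h2 : rHat t R (k + 1) h s a b - bonus K δ t (k + 1) h s a b ≤
    rTilde K δ t R (k + 1) h s a b := le_max_left _ _
  rw [bonus, if_neg (by omega), ← hL] at h2
  have h3 : √(4 * L / max (count₃ t (k + 1) h s a b : ℝ) 1) =
      2 * √L * (1 / √(max (count₃ t (k + 1) h s a b : ℝ) 1)) := by
    rw [Real.sqrt_div (by positivity), Real.sqrt_mul (by norm_num),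
      show (4 : ℝ) = 2 ^ 2 by norm_num, Real.sqrt_sq (by norm_num), mul_one_div]
  have h4 := mul_le_mul_of_nonneg_left (one_div_sqrt_max_anti (count₃_le_succ t k h s a b))
    (by positivity : 0 ≤ 4 * √L)
  rw [h3] at h1 h2
  linarith

/-- The regret decomposition on a good run: reward estimation, transition estimation and mirror
descent. -/
lemma GoodRun.regret₂_le [Nonempty B] (hg : GoodRun G K L t R μ ν) (hK : 1 ≤ K)
    (hL : L = Real.log ((Fintype.card S : ℝ) * Fintype.card A * Fintype.card B * H * K / δ))
    (hL0 : 0 ≤ L) (hrun : RunsAlgorithm G.s₁ K δ t R μ ν) (hμ : ∀ k < K, IsPolicy (μ (k + 1))) :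
    regret₂ G K μ ν ≤
      H * (4 * √L * (3 * √((Fintype.card S : ℝ) * Fintype.card A * Fintype.card B * K) +
        √(6 * L * K))) +
      (H : ℝ) ^ 2 * (√(32 * (Fintype.card S : ℝ) * L) *
        (3 * √((Fintype.card S : ℝ) * Fintype.card A * K) + √(6 * L * K))) +
      3 / 2 * (H * √((Fintype.card S : ℝ) * Real.log (Fintype.card B) * K)) := by
  have hν : ∀ k < K, IsPolicy (ν (k + 1)) := fun k hk => (hrun.2 k hk).1
  have _ : Nonempty {π : Policy S B H // IsPolicy π} := ⟨⟨ν 1, hν 0 hK⟩⟩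
  rw [regret₂, sub_le_comm]
  refine le_ciInf fun ⟨π, hπ⟩ => ?_
  rw [sub_le_comm, ← Finset.sum_sub_distrib, sum_Icc_one_eq_sum_range]
  have hle : ∀ k < K, value G (μ (k + 1)) (ν (k + 1)) - value G (μ (k + 1)) π ≤
      ∑ h, ∑ s, ∑ a, ∑ b,
        reach G.s₁ (μ (k + 1)) G.P h.castSucc s * μ (k + 1) h s a * ν (k + 1) h s b *
          (4 * √L * (1 / √(max (count₃ t k h s a b : ℝ) 1))) +
      ∑ h : Fin H, ∑ s, |reach G.s₁ (μ (k + 1)) G.P h.castSucc s -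
        reach G.s₁ (μ (k + 1)) (pHat t (k + 1)) h.castSucc s| +
      ∑ h, ∑ s, ∑ b, mdLoss G.s₁ K δ t R (k + 1) (μ (k + 1)) h s b *
        (ν (k + 1) h s b - π h s b) := by
    intro k hk
    rw [value_eq G (hμ k hk) (hν k hk), value_eq G (hμ k hk) hπ]
    simp only [← Finset.sum_sub_distrib, ← Finset.sum_add_distrib]
    refine Finset.sum_le_sum fun h _ => Finset.sum_le_sum fun s _ => ?_
    have h1 := loss_sub_le (q := reach G.s₁ (μ (k + 1)) G.P h.castSucc s)
      (d := reach G.s₁ (μ (k + 1)) (pHat t (k + 1)) h.castSucc s)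
      (reach_nonneg G.s₁ (hμ k hk) (fun h s a => (G.P_mem h s a).1) _ _)
      (hμ k hk h s) (hν k hk h s) (hπ h s) (r := G.r h s)
      (r' := rTilde K δ t R (k + 1) h s) (fun a b => le_max_right _ _)
      (hg.rTilde_le hL hk h s) (fun a b => (G.r_mem h s a b).2) (hg.sub_rTilde_le hL hL0 hk h s)
    simp only [Finset.sum_sub_distrib]
    exact h1
  refine (Finset.sum_le_sum fun k hk => hle k (Finset.mem_range.1 hk)).trans ?_
  rw [Finset.sum_add_distrib, Finset.sum_add_distrib]
  refine add_le_add (add_le_add ?_ (hg.sum_abs_reach_sub_le hμ))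
    (hrun.sum_mdLoss_le hK hμ (fun k hk h s a b =>
      (hg.rTilde_le hL hk h s a b).trans (G.r_mem h s a b).2) hπ)
  rw [Finset.sum_comm]
  calc _ = ∑ h : Fin H, 4 * √L * ∑ k ∈ Finset.range K, ∑ s, ∑ a, ∑ b,
        reach G.s₁ (μ (k + 1)) G.P h.castSucc s * μ (k + 1) h s a * ν (k + 1) h s b *
          (1 / √(max (count₃ t k h s a b : ℝ) 1)) := by
        simp only [Finset.mul_sum]
        refine Finset.sum_congr rfl fun h _ => Finset.sum_congr rfl fun k _ =>
          Finset.sum_congr rfl fun s _ => Finset.sum_congr rfl fun a _ =>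
          Finset.sum_congr rfl fun b _ => by ring
    _ ≤ ∑ h : Fin H, 4 * √L *
        (3 * √((Fintype.card S : ℝ) * Fintype.card A * Fintype.card B * K) + √(6 * L * K)) :=
        Finset.sum_le_sum fun h _ => mul_le_mul_of_nonneg_left (hg.visits₃ h) (by positivity)
    _ = _ := by simp

end Regret

/-- The three error terms are absorbed into the rate, using `L ≥ log 2` to bound `√L` and `1` by
multiples of `L`. -/
lemma regret_bound_le {s a b H K L : ℝ} (hs : 1 ≤ s) (ha : 1 ≤ a) (hb : 1 ≤ b) (hH : 1 ≤ H)
    (hK : 1 ≤ K) (hL : Real.log 2 ≤ L) :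
    H * (4 * √L * (3 * √(s * a * b * K) + √(6 * L * K))) +
      H ^ 2 * (√(32 * s * L) * (3 * √(s * a * K) + √(6 * L * K))) +
      3 / 2 * (H * √(s * Real.log b * K)) ≤
    50 * L * (√(s ^ 2 * a * H ^ 3) + √(s * a * b * H)) * √(K * H) := by
  have hlog2 := Real.log_two_gt_d9
  have hL0 : 0.69 ≤ L := by linarith
  set y := √L with hy
  have hyL : y ^ 2 = L := Real.sq_sqrt (by linarith)
  have hy0 : 0.8 ≤ y := Real.le_sqrt_of_sq_le (by norm_num; linarith)
  have hs0 : 0 < s := by linarith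
  have ha0 : 0 < a := by linarith
  have hb0 : 0 < b := by linarith
  have hK0 : 0 < K := by linarith
  have hH0 : 0 < H := by linarith
  set u := √(s * a * b * K) with hu
  set v := √(s * a * K) with hv
  have hu0 : 0 ≤ u := Real.sqrt_nonneg _
  have hv0 : 0 ≤ v := Real.sqrt_nonneg _
  have hsa : 1 ≤ s * a := one_le_mul_of_one_le_of_one_le hs ha
  have h6 : √(6 * L * K) ≤ 2.5 * y * √K := by
    rw [Real.sqrt_mul (by positivity), Real.sqrt_mul (by norm_num), ← hy]
    have : √6 ≤ 2.5 := Real.sqrt_le_iff.2 ⟨by norm_num, by norm_num⟩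
    gcongr
  have hKu : √K ≤ u := Real.sqrt_le_sqrt
    (le_mul_of_one_le_left hK0.le (one_le_mul_of_one_le_of_one_le hsa hb))
  have hKv : √K ≤ v := Real.sqrt_le_sqrt (le_mul_of_one_le_left hK0.le hsa)
  have h32 : √(32 * s * L) ≤ 6 * √s * y := by
    rw [Real.sqrt_mul (by positivity), Real.sqrt_mul (by norm_num), ← hy]
    have : √32 ≤ 6 := Real.sqrt_le_iff.2 ⟨by norm_num, by norm_num⟩
    gcongr
  have hlb : √(s * Real.log b * K) ≤ u := by
    refine Real.sqrt_le_sqrt (mul_le_mul_of_nonneg_right ?_ hK0.le)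
    have h1 : Real.log b ≤ b := (Real.log_le_self hb0.le)
    calc s * Real.log b ≤ s * b := mul_le_mul_of_nonneg_left h1 hs0.le
      _ ≤ s * a * b := mul_le_mul_of_nonneg_right (le_mul_of_one_le_right hs0.le ha) hb0.le
  have hC1 : √(s ^ 2 * a * H ^ 3) * √(K * H) = H ^ 2 * (√s * v) := by
    rw [hv, ← Real.sqrt_mul (by positivity), ← Real.sqrt_mul hs0.le]
    have : s ^ 2 * a * H ^ 3 * (K * H) = (H ^ 2) ^ 2 * (s * (s * a * K)) := by ring
    rw [this, Real.sqrt_mul (by positivity), Real.sqrt_sq (by positivity)]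
  have hC2 : √(s * a * b * H) * √(K * H) = H * u := by
    rw [hu, ← Real.sqrt_mul (by positivity)]
    have : s * a * b * H * (K * H) = H ^ 2 * (s * a * b * K) := by ring
    rw [this, Real.sqrt_mul (by positivity), Real.sqrt_sq hH0.le]
  have hkey : ∀ z, 0 ≤ z → √K ≤ z → y * (3 * z + √(6 * L * K)) ≤ 6.25 * L * z := by
    intro z hz hKz
    have h1 : √(6 * L * K) ≤ 2.5 * y * z :=
      h6.trans (mul_le_mul_of_nonneg_left hKz (by positivity))
    have h2 : y * (3 * z + √(6 * L * K)) ≤ y * (3 * z + 2.5 * y * z) :=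
      mul_le_mul_of_nonneg_left (by linarith) (by linarith)
    have h3 : 0 ≤ (1.25 * y ^ 2 - y) * z := mul_nonneg (by nlinarith) hz
    rw [hyL] at h3
    have h4 : y * (3 * z + 2.5 * y * z) = 3 * (y * z) + 2.5 * (y ^ 2 * z) := by ring
    rw [h4, hyL] at h2
    linarith
  have t1 : H * (4 * y * (3 * u + √(6 * L * K))) ≤ 25 * L * (H * u) := by
    have := mul_le_mul_of_nonneg_left (hkey u hu0 hKu) (by positivity : 0 ≤ 4 * H)
    linarith
  have t2 : H ^ 2 * (√(32 * s * L) * (3 * v + √(6 * L * K))) ≤ 37.5 * L * (H ^ 2 * (√s * v)) := by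
    have h1 : √(32 * s * L) * (3 * v + √(6 * L * K)) ≤
        6 * √s * y * (3 * v + √(6 * L * K)) :=
      mul_le_mul_of_nonneg_right h32 (by positivity)
    have h2 := mul_le_mul_of_nonneg_left (hkey v hv0 hKv) (by positivity : 0 ≤ 6 * √s)
    have h3 := mul_le_mul_of_nonneg_left (h1.trans (by linarith :
      6 * √s * y * (3 * v + √(6 * L * K)) ≤ 6 * √s * (6.25 * L * v)))
      (by positivity : 0 ≤ H ^ 2)
    linarith
  have t3 : 3 / 2 * (H * √(s * Real.log b * K)) ≤ 2.5 * L * (H * u) := by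
    have h1 : H * √(s * Real.log b * K) ≤ H * u := mul_le_mul_of_nonneg_left hlb hH0.le
    have h2 : 0 ≤ H * u := by positivity
    nlinarith
  have hr : 50 * L * (√(s ^ 2 * a * H ^ 3) + √(s * a * b * H)) * √(K * H) =
      50 * L * (H ^ 2 * (√s * v)) + 50 * L * (H * u) := by
    rw [← hC1, ← hC2]; ring
  rw [hr]
  have p1 : 0 ≤ L * (H ^ 2 * (√s * v)) := by positivity
  have p2 : 0 ≤ L * (H * u) := by positivity
  linarith

end MarkovGame

theorem theorem4 :
    ∃ (c : ℝ) (p : ℕ), 0 < c ∧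
      ∀ (S A B : Type*) [Fintype S] [DecidableEq S] [Fintype A] [DecidableEq A] [Nonempty A]
        [Fintype B] [DecidableEq B] [Nonempty B] (H K : ℕ) (_ : 1 ≤ H) (_ : 1 ≤ K)
        (G : MarkovGame.Game S A B H) (δ : ℝ) (_ : 0 < δ) (_ : δ < 1)
        (Ω : Type*) (mΩ : MeasurableSpace Ω) (Pr : Measure Ω) [IsProbabilityMeasure Pr]
        (ℱ : Filtration ℕ mΩ)
        (μ : ℕ → Ω → MarkovGame.Policy S A H) (ν : ℕ → Ω → MarkovGame.Policy S B H)
        (t : ℕ → Ω → MarkovGame.Traj S A B H) (R : ℕ → Ω → Fin H → ℝ)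
        (_ : MarkovGame.IsPlay G K Pr ℱ μ ν t R)
        (_ : ∀ ω, MarkovGame.RunsAlgorithm G.s₁ K δ
          (fun k => t k ω) (fun k => R k ω) (fun k => μ k ω) (fun k => ν k ω)),
        1 - 2 * δ ≤ Pr.real {ω |
          MarkovGame.regret₂ G K (fun k => μ k ω) (fun k => ν k ω) ≤
            c * Real.log ((Fintype.card S : ℝ) * Fintype.card A * Fintype.card B * H * K / δ) ^ p *
              (Real.sqrt ((Fintype.card S : ℝ) ^ 2 * Fintype.card A * (H : ℝ) ^ 3) +
                Real.sqrt ((Fintype.card S : ℝ) * Fintype.card A * Fintype.card B * H)) *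
              Real.sqrt ((K : ℝ) * H)} := by
  refine ⟨50, 1, by norm_num, ?_⟩
  intro S A B _ _ _ _ _ _ _ _ H K hH hK G δ hδ hδ1 Ω mΩ Pr _ ℱ μ ν t R hplay hrun
  rcases le_or_gt δ (1 / 2) with hδ2 | hδ2
  swap
  · exact le_trans (by linarith) measureReal_nonneg
  set L := Real.log ((Fintype.card S : ℝ) * Fintype.card A * Fintype.card B * H * K / δ) with hL
  have _ : Nonempty S := ⟨G.s₁⟩
  have hS1 : (1 : ℝ) ≤ Fintype.card S := by exact_mod_cast Fintype.card_pos
  have hA1 : (1 : ℝ) ≤ Fintype.card A := by exact_mod_cast Fintype.card_pos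
  have hB1 : (1 : ℝ) ≤ Fintype.card B := by exact_mod_cast Fintype.card_pos
  have hH1 : (1 : ℝ) ≤ H := by exact_mod_cast hH
  have hK1 : (1 : ℝ) ≤ K := by exact_mod_cast hK
  have hL2 : Real.log 2 ≤ L := by
    refine Real.log_le_log (by norm_num) ?_
    rw [le_div_iff₀ hδ]
    have h1 : (1 : ℝ) ≤ (Fintype.card S : ℝ) * Fintype.card A * Fintype.card B * H * K :=
      one_le_mul_of_one_le_of_one_le (one_le_mul_of_one_le_of_one_le
        (one_le_mul_of_one_le_of_one_le (one_le_mul_of_one_le_of_one_le hS1 hA1) hB1) hH1) hK1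
    linarith
  have hL0 : 0 ≤ L := (Real.log_nonneg (by norm_num)).trans hL2
  obtain ⟨bad, hbad, hgood⟩ := hplay.exists_goodRun hH hK
    (fun k hk ω => ((hrun ω).2 k hk).1) hδ hδ2 hL
  -- The regret event need not be measurable; subadditivity of the outer measure is enough.
  have hcov : 1 ≤ Pr.real bad + Pr.real badᶜ := by
    have h1 := measureReal_union_le (μ := Pr) bad badᶜ
    rwa [Set.union_compl_self, probReal_univ] at h1
  refine le_trans (by linarith : 1 - 2 * δ ≤ Pr.real badᶜ) (measureReal_mono fun ω hω => ?_)
  rw [Set.mem_ofPred_eq, pow_one]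
  exact ((hgood ω hω).regret₂_le hK hL hL0 (hrun ω) (fun k hk => hplay.policy₁ k hk ω)).trans
    (MarkovGame.regret_bound_le hS1 hA1 hB1 hH1 hK1 hL2)
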